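/- **Theorem 5 (Soundness of Algorithm $\mathcal R$).** Setting. There are two basic types (integers, booleans) and algebraic data types (ADTs) given by typed constructors, each ADT having at least one ground constructor term. A constraint is a quantifier-free formula of linear integer arithmetic and booleans. A constrained Horn clause $H\leftarrow c,B$ has as head $H$ an atom or $\mathit{false}$, a constraint $c$, and a finite conjunction $B$ of atoms; every term of basic type in an atom is a variable. A set of clauses is satisfiable if some interpretation of the predicate symbols over the integers, the booleans and the ground constructor terms makes all its clauses true. $M(P)$ is the least model of a set $P$ of definite clauses (those whose head is an atom). An atom or clause has basic types if all arguments of its atoms have a basic type. For a level mapping $\ell$ (from predicates to $\mathbb N$, with $\ell(\mathit{false})=\infty$), a clause is stratified if no body atom has a level greater than that of the head. Some argument positions of each predicate are designated as input, the others as output; $\prec$ is an ordering on tuples of terms. In a conjunction $G$, a source variable is a variable that is in an input position of some atom of $G$ and in no output position of an atom of $G$; a source atom is an atom of $G$ all of whose input variables are source variables. A conjunction $F$ is functional (total) from $X$ to $Y$ in $M$, where $X,Y$ partition $\mathit{vars}(F)$, if in $M$ every value of $X$ has at most (at least) one value of $Y$ making $F$ true; $F(X;Y)$ says that it is both. Let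 $\mathit{Cls}=\mathit{Ds}\cup\mathit{Gs}$, with $\mathit{Ds}$ the definite clauses and $\mathit{Gs}$ the goals (clauses with head $\mathit{false}$). Algorithm $\mathcal R$ starts with $\mathit{InCls}=\mathit{Gs}$, $\mathit{Defs}=\mathit{TransfCls}=\emptyset$, and, while $\mathit{InCls}\ne\emptyset$, executes (1)–(3) below and then sets $\mathit{InCls}:=\mathit{RCls}$, $\mathit{Defs}:=\mathit{Defs}\cup\mathit{NewDefs}$, $\mathit{TransfCls}:=\mathit{TransfCls}\cup\mathit{FldCls}$. (1) *Diff-Define-Fold* starts with $\mathit{NewDefs}=\mathit{FldCls}=\emptyset$ and runs until $\mathit{InCls}$ is empty. A clause of $\mathit{InCls}$ with basic types is moved to $\mathit{FldCls}$. Any other clause $C\colon H\leftarrow c,B,G'$, where $B$ is a block containing an atom with an ADT argument (blocks are the classes of body atoms under the reflexive transitive closure of "sharing an ADT variable"), is replaced in $\mathit{InCls}$ by a clause $E$. Let $D\colon \mathit{newp}(U)\leftarrow d,B'$ range over variants of clauses in $\mathit{Defs}\cup\mathit{NewDefs}$ with $U$ the variables of basic type of $d,B'$. The first applicable case is taken: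 - *Fold:* $B=B'\vartheta$ for some $D$ and some $\vartheta$ acting on ADT variables of $B'$ only, and $c\rightarrow d$ is valid; $E$ is $H\leftarrow c,\mathit{newp}(U),G'$. - *Generalize:* the same, but $c\rightarrow d$ is not valid; for some constraint $a$ implied by $c$ and by $d$, the definition $\mathit{genp}(U)\leftarrow a,B'$ is added to $\mathit{NewDefs}$, and $E$ is $H\leftarrow c,\mathit{genp}(U),G'$. - *Diff-Introduce:* for some $D$, the atoms of $B'$ are generalizations of pairwise distinct atom occurrences of $B$, and there is a subconjunction $M$ of $B$, maximal such that: $M$ is connected (consists of one block), $B=(M,F(X;Y))$ with $F$ non-empty, $B'\vartheta=(M,R(V;W))$ for some $\vartheta$ acting on ADT variables of $B'$ only, $W\cap\mathit{vars}(C)=\emptyset$, and $\ell(H)>\ell(A)$ for every atom $A$ of $F$; totality and functionality are meant in $M(\mathit{Ds}\cup\mathit{Defs}\cup\mathit{NewDefs})$. The definition $\mathit{diff}(Z)\leftarrow\pi,F,R$ is added to $\mathit{NewDefs}$, where $\pi$ is a constraint implied by $c$ with $\mathit{vars}(\pi)\subseteq X$, and $Z$ are the variables of basic type of $F,R$. If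 $c\rightarrow d$ is valid, $E$ is $H\leftarrow c,\mathit{newp}(U),\mathit{diff}(Z),G'$; otherwise $\mathit{genp}(U)\leftarrow a,B'$ is added too, with $a$ as above, and $E$ is $H\leftarrow c,\mathit{genp}(U),\mathit{diff}(Z),G'$. - *Project:* $\mathit{newp}(U)\leftarrow\pi,B$ is added to $\mathit{NewDefs}$, where $U$ are the variables of basic type of $B$ and $\pi$ is a constraint implied by $c$ all of whose variables are input variables of basic type in $B$; $E$ is $H\leftarrow c,\mathit{newp}(U),G'$. The head predicate of every definition added is new, and its level is the maximum level of the atoms in the body of the definition. (2) *Unfold.* Unfolding a clause $H\leftarrow c,L,A,R$ with respect to $A$ replaces it by the clauses $(H\leftarrow c,c_j,L,B_j,R)\vartheta_j$, for all (renamed apart) clauses $K_j\leftarrow c_j,B_j$ of $\mathit{Ds}$ such that $A$ and $K_j$ have a most general unifier $\vartheta_j$ and $(c,c_j)\vartheta_j$ is satisfiable; repeated variables of basic type may be replaced by new ones equated with them in the constraint. Phase 1: in each clause $H\leftarrow c,B$ of $\mathit{NewDefs}$ a set of body atoms is marked, which consists of an atom $A$ with $\ell(A)=\ell(H)$ and of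 source atoms, and in which all source variables of $B$ occur; then unfolding with respect to marked atoms is repeated until none is left (inherited atoms keep their marking, derived ones are unmarked). Phase 2: all body atoms are marked; then, as long as possible, clauses are unfolded with respect to atoms that are head-instances (for each clause of $\mathit{Ds}$ usable for unfolding the atom, the most general unifier only renames the atom's input variables) and are marked or have a descending predicate ($p$ is descending if in all clauses of $\mathit{Ds}$ with head $p(t;u)$, each body atom $p_i(t_i;u_i)$ whose predicate depends on $p$ has $t_i\prec t$). The result is $\mathit{UnfCls}$. (3) *Replace* starts with $\mathit{RCls}=\mathit{UnfCls}$ and applies the following rules to clauses of $\mathit{RCls}$ as long as possible: delete a clause whose constraint is unsatisfiable; replace, in a body, $F(X,Y),F(X,Z)$ by $Y=Z,F(X,Y)$, if the non-empty conjunction $F(X,Y)$ is functional from $X$ to $Y$ in $M(\mathit{RCls}\cup\mathit{Ds})$ (equalities between ADT variables are solved by a most general unifier); delete from a body a non-empty conjunction $F(X,Y)$ that is total from $X$ to $Y$ in $M(\mathit{RCls}\cup\mathit{Ds})$, if the variables $Y$ do not occur elsewhere in the clause. Claim. Let $\mathit{Cls}$ be stratified with respect to $\ell$, and suppose that some execution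 of Algorithm $\mathcal R$ on $\mathit{Cls}$ terminates with output $\mathit{TransfCls}$. Then every clause of $\mathit{TransfCls}$ has basic types. Moreover, suppose that no head predicate of a definite clause of $\mathit{Cls}$ occurs in $\mathit{TransfCls}$ (which, by the first claim, is automatic if every head predicate of $\mathit{Cls}$ has at least one argument of ADT type). Then, if $\mathit{TransfCls}$ is satisfiable, $\mathit{Cls}$ is satisfiable. -/

import Mathlib

namespace CHC

universe u

/-! ### Types, signatures, terms -/

/-- The types: the two basic types and the algebraic data types (ADTs) named by `A`. -/
inductive Ty (A : Type u) : Type u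
  | int : Ty A
  | bool : Ty A
  | adt (a : A) : Ty A

/-- The basic types are the integer and the boolean type. -/
def Ty.Basic {A : Type u} : Ty A → Prop
  | .int => True
  | .bool => True
  | .adt _ => False

/-- The data-type declarations (ADT names and typed constructors, constants being constructors
without arguments) and the typed predicate symbols. -/
structure Sig where
  Adt : Type u
  Con : Type u
  conArity : Con → ℕ
  conArg : (f : Con) → Fin (conArity f) → Ty Adt
  conRes : Con → Adt
  Pred : Type u
  arity : Pred → ℕ
  arg : (p : Pred) → Fin (arity p) → Ty Adt

variable {S : Sig.{u}}

/-- Typed variables: a type together with a name. -/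
abbrev Var (S : Sig.{u}) : Type u := Ty S.Adt × ℕ

/-- The typed terms that may occur as arguments of atoms.  The typing makes every term of basic
type a variable. -/
inductive Term (S : Sig.{u}) : Ty S.Adt → Type u
  | var (τ : Ty S.Adt) (x : ℕ) : Term S τ
  | app (f : S.Con) (args : (i : Fin (S.conArity f)) → Term S (S.conArg f i)) :
      Term S (.adt (S.conRes f))

/-- The elements of the types: integers, truth values, and ground constructor terms. -/
inductive Val (S : Sig.{u}) : Ty S.Adt → Type u
  | int (n : ℤ) : Val S .int
  | bool (b : Bool) : Val S .bool
  | app (f : S.Con) (args : (i : Fin (S.conArity f)) → Val S (S.conArg f i)) :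
      Val S (.adt (S.conRes f))

def Val.toInt : Val S .int → ℤ
  | .int n => n

def Val.toBool : Val S .bool → Bool
  | .bool b => b

abbrev Subst (S : Sig.{u}) : Type u := (τ : Ty S.Adt) → ℕ → Term S τ

abbrev Valuation (S : Sig.{u}) : Type u := (τ : Ty S.Adt) → ℕ → Val S τ

def Term.vars {τ : Ty S.Adt} : Term S τ → Set (Var S)
  | .var τ x => {(τ, x)}
  | .app _ args => ⋃ i, (args i).vars

def Term.subst (σ : Subst S) {τ : Ty S.Adt} : Term S τ → Term S τ
  | .var τ x => σ τ x
  | .app f args => .app f (fun i => (args i).subst σ)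

def Term.eval (v : Valuation S) {τ : Ty S.Adt} : Term S τ → Val S τ
  | .var τ x => v τ x
  | .app f args => .app f (fun i => (args i).eval v)

/-- `σ.comp γ` applies `σ` first and then `γ`. -/
def Subst.comp (σ γ : Subst S) : Subst S := fun τ x => (σ τ x).subst γ

/-- The substitution given by a (not necessarily injective) map of variable names. -/
def Subst.ofNames (ρ : Ty S.Adt → ℕ → ℕ) : Subst S := fun τ x => .var τ (ρ τ x)

/-- `σ` is the identity outside the set `V` of variables. -/
def Subst.ActsOnlyOn (σ : Subst S) (V : Set (Var S)) : Prop :=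
  ∀ τ x, (τ, x) ∉ V → σ τ x = .var τ x

/-- `θ` is a most general substitution with the property `U` (of being a unifier). -/
def IsMostGeneral (U : Subst S → Prop) (θ : Subst S) : Prop :=
  U θ ∧ ∀ σ, U σ → ∃ γ : Subst S, σ = θ.comp γ

/-! ### Constraints: quantifier-free formulas of linear integer arithmetic and booleans -/

/-- Linear integer expressions (a term of type `int` is a variable). -/
inductive LinExp (S : Sig.{u}) : Type u
  | tm (t : Term S .int) : LinExp S
  | const (n : ℤ) : LinExp S
  | add (s t : LinExp S) : LinExp S
  | smul (k : ℤ) (t : LinExp S) : LinExp S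

/-- Constraints (a term of type `bool` is a variable). -/
inductive Cstr (S : Sig.{u}) : Type u
  | tru : Cstr S
  | fls : Cstr S
  | isTrue (t : Term S .bool) : Cstr S
  | eq (s t : LinExp S) : Cstr S
  | le (s t : LinExp S) : Cstr S
  | neg (c : Cstr S) : Cstr S
  | and (c d : Cstr S) : Cstr S
  | or (c d : Cstr S) : Cstr S
  | iff (c d : Cstr S) : Cstr S

def LinExp.vars : LinExp S → Set (Var S)
  | .tm t => t.vars
  | .const _ => ∅
  | .add s t => s.vars ∪ t.vars
  | .smul _ t => t.vars

def LinExp.subst (σ : Subst S) : LinExp S → LinExp S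
  | .tm t => .tm (t.subst σ)
  | .const n => .const n
  | .add s t => .add (s.subst σ) (t.subst σ)
  | .smul k t => .smul k (t.subst σ)

def LinExp.eval (v : Valuation S) : LinExp S → ℤ
  | .tm t => (t.eval v).toInt
  | .const n => n
  | .add s t => s.eval v + t.eval v
  | .smul k t => k * t.eval v

def Cstr.vars : Cstr S → Set (Var S)
  | .tru => ∅
  | .fls => ∅
  | .isTrue t => t.vars
  | .eq s t => s.vars ∪ t.vars
  | .le s t => s.vars ∪ t.vars
  | .neg c => c.vars
  | .and c d => c.vars ∪ d.vars
  | .or c d => c.vars ∪ d.vars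
  | .iff c d => c.vars ∪ d.vars

def Cstr.subst (σ : Subst S) : Cstr S → Cstr S
  | .tru => .tru
  | .fls => .fls
  | .isTrue t => .isTrue (t.subst σ)
  | .eq s t => .eq (s.subst σ) (t.subst σ)
  | .le s t => .le (s.subst σ) (t.subst σ)
  | .neg c => .neg (c.subst σ)
  | .and c d => .and (c.subst σ) (d.subst σ)
  | .or c d => .or (c.subst σ) (d.subst σ)
  | .iff c d => .iff (c.subst σ) (d.subst σ)

def Cstr.Holds (v : Valuation S) : Cstr S → Prop
  | .tru => True
  | .fls => False
  | .isTrue t => (t.eval v).toBool = true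
  | .eq s t => s.eval v = t.eval v
  | .le s t => s.eval v ≤ t.eval v
  | .neg c => ¬ c.Holds v
  | .and c d => c.Holds v ∧ d.Holds v
  | .or c d => c.Holds v ∨ d.Holds v
  | .iff c d => (c.Holds v ↔ d.Holds v)

def Cstr.Sat (c : Cstr S) : Prop := ∃ v, c.Holds v

/-- Validity of the universal closure of `c → d`. -/
def Cstr.Entails (c d : Cstr S) : Prop := ∀ v, c.Holds v → d.Holds v

/-- `a` is a generalization of the pair `(c, d)`. -/
def IsGeneralization (c d a : Cstr S) : Prop := c.Entails a ∧ d.Entails a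

/-- `p` is a projection of `c` onto the variables `V`. -/
def IsProjection (c : Cstr S) (V : Set (Var S)) (p : Cstr S) : Prop :=
  p.vars ⊆ V ∧ c.Entails p

/-- The constraint `x = y` between two variables of the same basic type. -/
def Cstr.eqNames : Ty S.Adt → ℕ → ℕ → Cstr S
  | .int, x, y => .eq (.tm (.var .int x)) (.tm (.var .int y))
  | .bool, x, y => .iff (.isTrue (.var .bool x)) (.isTrue (.var .bool y))
  | .adt _, _, _ => .tru

/-- The conjunction of the constraints `y = ρ y`, for the variables `y` of basic type in `Y`. -/
def Cstr.eqAll (ρ : Ty S.Adt → ℕ → ℕ) (Y : List (Var S)) : Cstr S :=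
  Y.foldr (fun y c => .and (Cstr.eqNames y.1 y.2 (ρ y.1 y.2)) c) .tru

/-! ### Atoms, conjunctions of atoms, clauses -/

structure Atom (S : Sig.{u}) : Type u where
  pred : S.Pred
  args : (i : Fin (S.arity pred)) → Term S (S.arg pred i)

namespace Atom

def vars (A : Atom S) : Set (Var S) := ⋃ i, (A.args i).vars

def adtVars (A : Atom S) : Set (Var S) := {x | x ∈ A.vars ∧ ¬ x.1.Basic}

def subst (σ : Subst S) (A : Atom S) : Atom S := ⟨A.pred, fun i => (A.args i).subst σ⟩

def HasBasicTypes (A : Atom S) : Prop := ∀ i, (S.arg A.pred i).Basic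

/-- The atom is `p(U)`, for a tuple of distinct variables of basic type whose set is `U`. -/
def IsTuple (A : Atom S) (U : Set (Var S)) : Prop :=
  A.HasBasicTypes ∧
  (∀ i j, (⟨_, A.args i⟩ : (τ : Ty S.Adt) × Term S τ) = ⟨_, A.args j⟩ → i = j) ∧
  A.vars = U

end Atom

/-- Conjunctions of atoms, modulo the order of the atoms. -/
abbrev Conj (S : Sig.{u}) : Type u := Multiset (Atom S)

namespace Conj

def vars (G : Conj S) : Set (Var S) := {x | ∃ A ∈ G, x ∈ A.vars}

def bvars (G : Conj S) : Set (Var S) := {x | x ∈ Conj.vars G ∧ x.1.Basic}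

def adtVars (G : Conj S) : Set (Var S) := {x | x ∈ Conj.vars G ∧ ¬ x.1.Basic}

def subst (σ : Subst S) (G : Conj S) : Conj S := G.map (Atom.subst σ)

/-- The reflexive, transitive closure of the relation of sharing an ADT variable, on the atoms
of `G`. -/
def Linked (G : Conj S) : Atom S → Atom S → Prop :=
  Relation.ReflTransGen fun A A' => A ∈ G ∧ A' ∈ G ∧ (A.adtVars ∩ A'.adtVars).Nonempty

/-- `B` is a sharing block of the conjunction that consists of `B` and `G'`. -/
def IsSharingBlock (B G' : Conj S) : Prop :=
  ∃ A ∈ B, (∀ A' ∈ B, Linked (B + G') A A') ∧ ∀ A' ∈ G', ¬ Linked (B + G') A A'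

/-- `G` is its own only sharing block. -/
def Connected (G : Conj S) : Prop := IsSharingBlock G 0

/-- `G₁` atomwise subsumes `G₂`. -/
def AtomwiseSubsumes (G₁ G₂ : Conj S) : Prop :=
  ∃ G ≤ G₂, Multiset.Rel (fun A B => ∃ θ : Subst S, B = A.subst θ) G₁ G

end Conj

/-- A constrained Horn clause; the head `none` stands for `false`. -/
structure Clause (S : Sig.{u}) : Type u where
  head : Option (Atom S)
  con : Cstr S
  body : Conj S

namespace Clause

def vars (C : Clause S) : Set (Var S) :=
  {x | ∃ A, C.head = some A ∧ x ∈ A.vars} ∪ C.con.vars ∪ Conj.vars C.body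

def subst (σ : Subst S) (C : Clause S) : Clause S :=
  ⟨C.head.map (Atom.subst σ), C.con.subst σ, Conj.subst σ C.body⟩

/-- `C` and `D` are equal up to a renaming of variables (and the order of the body atoms). -/
def IsVariant (C D : Clause S) : Prop :=
  ∃ ρ : Ty S.Adt → Equiv.Perm ℕ, C = D.subst (Subst.ofNames fun τ x => ρ τ x)

/-- All arguments of all atoms of the clause have a basic type. -/
def HasBasicTypes (C : Clause S) : Prop :=
  (∀ A, C.head = some A → A.HasBasicTypes) ∧ ∀ A ∈ C.body, A.HasBasicTypes

/-- The predicate symbol `p` occurs in the clause. -/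
def Mentions (C : Clause S) (p : S.Pred) : Prop :=
  (∃ A, C.head = some A ∧ A.pred = p) ∨ ∃ A ∈ C.body, A.pred = p

end Clause

/-- The definite clauses of a set of clauses. -/
def definite (P : Set (Clause S)) : Set (Clause S) := {C ∈ P | C.head ≠ none}

/-- The goals of a set of clauses. -/
def goals (P : Set (Clause S)) : Set (Clause S) := {C ∈ P | C.head = none}

/-! ### Interpretations, satisfiability, least models -/

/-- Interpretations, as sets of ground atoms over the fixed domains `Val S`. -/
abbrev Interp (S : Sig.{u}) : Type u :=
  (p : S.Pred) → ((i : Fin (S.arity p)) → Val S (S.arg p i)) → Prop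

def Atom.Holds (I : Interp S) (v : Valuation S) (A : Atom S) : Prop :=
  I A.pred fun i => (A.args i).eval v

def Conj.Holds (I : Interp S) (v : Valuation S) (G : Conj S) : Prop := ∀ A ∈ G, A.Holds I v

/-- The universal closure of the clause is true in `I`. -/
def Clause.Holds (I : Interp S) (C : Clause S) : Prop :=
  ∀ v, C.con.Holds v → Conj.Holds I v C.body → ∃ A, C.head = some A ∧ A.Holds I v

def IsModel (I : Interp S) (P : Set (Clause S)) : Prop := ∀ C ∈ P, C.Holds I

def Satisfiable (P : Set (Clause S)) : Prop := ∃ I, IsModel I P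

/-- The least model of a set of definite clauses: the ground atoms true in all its models. -/
def leastModel (P : Set (Clause S)) : Interp S := fun p a => ∀ I, IsModel I P → I p a

/-- `X` and `Y` are disjoint and consist of all the variables of `G`. -/
def IsSplit (G : Conj S) (X Y : Set (Var S)) : Prop :=
  Disjoint X Y ∧ X ∪ Y = Conj.vars G

/-- `G` is functional from `X` to `Y` in the interpretation `I`. -/
def Functional (I : Interp S) (G : Conj S) (X Y : Set (Var S)) : Prop :=
  ∀ v w : Valuation S, (∀ x ∈ X, v x.1 x.2 = w x.1 x.2) →
    Conj.Holds I v G → Conj.Holds I w G → ∀ y ∈ Y, v y.1 y.2 = w y.1 y.2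

/-- `G` is total from `X` to `Y` in the interpretation `I`, where `X ∪ Y` are the variables
of `G`. -/
def Total (I : Interp S) (G : Conj S) (X : Set (Var S)) : Prop :=
  ∀ v : Valuation S, ∃ w : Valuation S,
    (∀ x ∈ X, w x.1 x.2 = v x.1 x.2) ∧ Conj.Holds I w G

/-- `G` is a total, functional conjunction `G(X;Y)` in `I`. -/
def TotalFunctional (I : Interp S) (G : Conj S) (X Y : Set (Var S)) : Prop :=
  IsSplit G X Y ∧ Functional I G X Y ∧ Total I G X

/-! ### Level mappings -/

/-- The level of a head; `false` is above all predicates. -/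
def headLevel (l : S.Pred → ℕ) : Option (Atom S) → WithTop ℕ
  | none => ⊤
  | some A => (l A.pred : WithTop ℕ)

def Stratified (l : S.Pred → ℕ) (P : Set (Clause S)) : Prop :=
  ∀ C ∈ P, ∀ A ∈ C.body, (l A.pred : WithTop ℕ) ≤ headLevel l C.head

/-- The maximum level of the atoms of a conjunction. -/
def maxLevel (l : S.Pred → ℕ) (G : Conj S) : ℕ := (G.map fun A => l A.pred).sup

/-- `K` is the head `newp(U)` of a new definition with body atoms `B`: its predicate does not
occur in the clauses `Old`, and has the maximum level of the atoms in `B`. -/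
def IsNewHead (l : S.Pred → ℕ) (Old : Set (Clause S)) (K : Atom S) (U : Set (Var S))
    (B : Conj S) : Prop :=
  K.IsTuple U ∧ (∀ C ∈ Old, ¬ C.Mentions K.pred) ∧ l K.pred = maxLevel l B

/-! ### Input and output arguments -/

/-- A mode says which argument positions of each predicate are input positions; the other ones
are output positions. -/
abbrev Mode (S : Sig.{u}) : Type u := (p : S.Pred) → Fin (S.arity p) → Bool

def Mode.inVars (m : Mode S) (A : Atom S) : Set (Var S) :=
  {x | ∃ i, m A.pred i = true ∧ x ∈ (A.args i).vars}

def Mode.outVars (m : Mode S) (A : Atom S) : Set (Var S) :=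
  {x | ∃ i, m A.pred i = false ∧ x ∈ (A.args i).vars}

/-- The tuple of the input arguments of an atom. -/
def Mode.inArgs (m : Mode S) (A : Atom S) : List ((τ : Ty S.Adt) × Term S τ) :=
  ((List.finRange _).filter fun i => m A.pred i).map fun i => ⟨_, A.args i⟩

/-- The source variables of a conjunction. -/
def Mode.sourceVars (m : Mode S) (G : Conj S) : Set (Var S) :=
  {x | (∃ A ∈ G, x ∈ m.inVars A) ∧ ∀ A ∈ G, x ∉ m.outVars A}

/-- `A` is a source atom of the conjunction `G`. -/
def Mode.IsSource (m : Mode S) (G : Conj S) (A : Atom S) : Prop :=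
  A ∈ G ∧ m.inVars A ⊆ m.sourceVars G

/-! ### The procedure Diff-Define-Fold -/

/-- The choice of a sharing block `B` of the body of `C` that contains an atom with ADTs, `G'`
being the rest of the body. -/
def Selected (C : Clause S) (B G' : Conj S) : Prop :=
  C.body = B + G' ∧ Conj.IsSharingBlock B G' ∧ ∃ A ∈ B, ¬ A.HasBasicTypes

/-- `D` is a variant `K ← d, B'` of a definition in `Δ`, where the arguments of `K` are
the variables of basic type of `d, B'`. -/
def IsDefVariant (Δ : Set (Clause S)) (D : Clause S) (K : Atom S) : Prop :=
  (∃ D₀ ∈ Δ, D.IsVariant D₀) ∧ D.head = some K ∧ K.IsTuple (D.con.vars ∪ Conj.bvars D.body)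

/-- `D : K ← d, B'` is a definition in `Δ` (up to variants) such that `B = B'θ` for a
substitution `θ` acting on the ADT variables of `B'` only. -/
def Matches (Δ : Set (Clause S)) (B : Conj S) (D : Clause S) (K : Atom S) : Prop :=
  IsDefVariant Δ D K ∧
  ∃ θ : Subst S, θ.ActsOnlyOn (Conj.adtVars D.body) ∧ B = Conj.subst θ D.body

/-- The conditions on `B = (M, F(X;Y))` and `B'θ = (M, R(V;W))` for introducing a difference
predicate in the clause `C` using the definition `D : K ← d, B'`; `I` is the model that
gives the meaning of totality and functionality. -/
def DiffSplit (l : S.Pred → ℕ) (I : Interp S) (C : Clause S) (B : Conj S) (D : Clause S)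
    (M F R : Conj S) (X Y V W : Set (Var S)) : Prop :=
  Conj.Connected M ∧
  (B = M + F ∧ F ≠ 0 ∧ TotalFunctional I F X Y) ∧
  ((∃ θ : Subst S, θ.ActsOnlyOn (Conj.adtVars D.body) ∧ Conj.subst θ D.body = M + R) ∧
    TotalFunctional I R V W ∧ Disjoint W C.vars) ∧
  ∀ A ∈ F, (l A.pred : WithTop ℕ) < headLevel l C.head

/-- `DiffSplit` for a maximal `M`. -/
def MaxDiffSplit (l : S.Pred → ℕ) (I : Interp S) (C : Clause S) (B : Conj S) (D : Clause S)
    (M F R : Conj S) (X Y V W : Set (Var S)) : Prop :=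
  DiffSplit l I C B D M F R X Y V W ∧
  ∀ M' F' R' X' Y' V' W', DiffSplit l I C B D M' F' R' X' Y' V' W' → M ≤ M' → M' = M

/-- Some definition in `Δ` has a body that atomwise subsumes `B`. -/
def PartiallyMatched (Δ : Set (Clause S)) (B : Conj S) : Prop :=
  ∃ D K, IsDefVariant Δ D K ∧ Conj.AtomwiseSubsumes D.body B

/-- For every definition in `Δ` whose body atomwise subsumes `B`, some variant of it admits
a split as required for introducing a difference predicate. -/
def DiffPossible (l : S.Pred → ℕ) (I : Interp S) (Δ : Set (Clause S)) (C : Clause S)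
    (B : Conj S) : Prop :=
  ∀ D₀ ∈ Δ, (∃ D K, IsDefVariant {D₀} D K ∧ Conj.AtomwiseSubsumes D.body B) →
    ∃ D K, IsDefVariant {D₀} D K ∧ ∃ M F R X Y V W, DiffSplit l I C B D M F R X Y V W

/-- The variables of the procedure: `InCls`, `NewDefs`, `FldCls`. -/
structure DDFState (S : Sig.{u}) : Type u where
  inCls : Set (Clause S)
  newDefs : Set (Clause S)
  fldCls : Set (Clause S)

/-- One execution of the body of the loop of the procedure; `Cls` is the input of the whole
algorithm, and `Defs` the set of the definitions introduced in earlier iterations. -/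
inductive DDFStep (m : Mode S) (l : S.Pred → ℕ) (Cls Defs : Set (Clause S)) :
    DDFState S → DDFState S → Prop
  | basic (I N L : Set (Clause S)) (C : Clause S) (hC : C ∈ I) (hb : C.HasBasicTypes) :
      DDFStep m l Cls Defs ⟨I, N, L⟩ ⟨I \ {C}, N, insert C L⟩
  | fold (I N L : Set (Clause S)) (C : Clause S) (hC : C ∈ I) (hb : ¬ C.HasBasicTypes)
      (B G' : Conj S) (hB : Selected C B G')
      (D : Clause S) (K : Atom S) (hD : Matches (Defs ∪ N) B D K)
      (hcd : C.con.Entails D.con) :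
      DDFStep m l Cls Defs ⟨I, N, L⟩
        ⟨insert ⟨C.head, C.con, K ::ₘ G'⟩ (I \ {C}), N, L⟩
  | generalize (I N L : Set (Clause S)) (C : Clause S) (hC : C ∈ I) (hb : ¬ C.HasBasicTypes)
      (B G' : Conj S) (hB : Selected C B G')
      (hnofold : ¬ ∃ D K, Matches (Defs ∪ N) B D K ∧ C.con.Entails D.con)
      (D : Clause S) (K : Atom S) (hD : Matches (Defs ∪ N) B D K)
      (a : Cstr S) (ha : IsGeneralization D.con C.con a)
      (genp : Atom S)
      (hgen : IsNewHead l (Cls ∪ Defs ∪ N) genp (D.con.vars ∪ Conj.bvars D.body) D.body) :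
      DDFStep m l Cls Defs ⟨I, N, L⟩
        ⟨insert ⟨C.head, C.con, genp ::ₘ G'⟩ (I \ {C}),
          insert ⟨some genp, a, D.body⟩ N, L⟩
  | diffFold (I N L : Set (Clause S)) (C : Clause S) (hC : C ∈ I) (hb : ¬ C.HasBasicTypes)
      (B G' : Conj S) (hB : Selected C B G')
      (hnomatch : ¬ ∃ D K, Matches (Defs ∪ N) B D K)
      (D : Clause S) (K : Atom S) (hD : IsDefVariant (Defs ∪ N) D K)
      (hsub : Conj.AtomwiseSubsumes D.body B)
      (M F R : Conj S) (X Y V W : Set (Var S))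
      (hsplit : MaxDiffSplit l (leastModel (definite Cls ∪ Defs ∪ N)) C B D M F R X Y V W)
      (π : Cstr S) (hπ : IsProjection C.con X π)
      (diff : Atom S)
      (hdiff : IsNewHead l (Cls ∪ Defs ∪ N) diff (Conj.bvars (F + R)) (F + R))
      (hcd : C.con.Entails D.con) :
      DDFStep m l Cls Defs ⟨I, N, L⟩
        ⟨insert ⟨C.head, C.con, K ::ₘ diff ::ₘ G'⟩ (I \ {C}),
          insert ⟨some diff, π, F + R⟩ N, L⟩
  | diffGeneralize (I N L : Set (Clause S)) (C : Clause S) (hC : C ∈ I)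
      (hb : ¬ C.HasBasicTypes) (B G' : Conj S) (hB : Selected C B G')
      (hnomatch : ¬ ∃ D K, Matches (Defs ∪ N) B D K)
      (D : Clause S) (K : Atom S) (hD : IsDefVariant (Defs ∪ N) D K)
      (hsub : Conj.AtomwiseSubsumes D.body B)
      (M F R : Conj S) (X Y V W : Set (Var S))
      (hsplit : MaxDiffSplit l (leastModel (definite Cls ∪ Defs ∪ N)) C B D M F R X Y V W)
      (π : Cstr S) (hπ : IsProjection C.con X π)
      (diff : Atom S)
      (hdiff : IsNewHead l (Cls ∪ Defs ∪ N) diff (Conj.bvars (F + R)) (F + R))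
      (hcd : ¬ C.con.Entails D.con)
      (a : Cstr S) (ha : IsGeneralization D.con C.con a)
      (genp : Atom S)
      (hgen : IsNewHead l (Cls ∪ Defs ∪ insert ⟨some diff, π, F + R⟩ N) genp
        (D.con.vars ∪ Conj.bvars D.body) D.body) :
      DDFStep m l Cls Defs ⟨I, N, L⟩
        ⟨insert ⟨C.head, C.con, genp ::ₘ diff ::ₘ G'⟩ (I \ {C}),
          insert ⟨some genp, a, D.body⟩ (insert ⟨some diff, π, F + R⟩ N), L⟩
  | project (I N L : Set (Clause S)) (C : Clause S) (hC : C ∈ I) (hb : ¬ C.HasBasicTypes)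
      (B G' : Conj S) (hB : Selected C B G')
      (hnomatch : ¬ ∃ D K, Matches (Defs ∪ N) B D K)
      (hnodiff : ¬ (PartiallyMatched (Defs ∪ N) B ∧
        DiffPossible l (leastModel (definite Cls ∪ Defs ∪ N)) (Defs ∪ N) C B))
      (π : Cstr S)
      (hπ : IsProjection C.con {x | x.1.Basic ∧ ∃ A ∈ B, x ∈ m.inVars A} π)
      (newp : Atom S)
      (hnew : IsNewHead l (Cls ∪ Defs ∪ N) newp (Conj.bvars B) B) :
      DDFStep m l Cls Defs ⟨I, N, L⟩
        ⟨insert ⟨C.head, C.con, newp ::ₘ G'⟩ (I \ {C}),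
          insert ⟨some newp, π, B⟩ N, L⟩

/-- The procedure Diff-Define-Fold, with inputs `InCls`, `Defs` and outputs `NewDefs`,
`FldCls`. -/
def DiffDefineFold (m : Mode S) (l : S.Pred → ℕ) (Cls InCls Defs NewDefs FldCls :
    Set (Clause S)) : Prop :=
  Relation.ReflTransGen (DDFStep m l Cls Defs) ⟨InCls, ∅, ∅⟩ ⟨∅, NewDefs, FldCls⟩

/-! ### The procedure Unfold -/

/-- A clause whose body atoms are partitioned into those marked as unfoldable and the rest. -/
structure MClause (S : Sig.{u}) : Type u where
  head : Option (Atom S)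
  con : Cstr S
  marked : Conj S
  rest : Conj S

def MClause.toClause (P : MClause S) : Clause S := ⟨P.head, P.con, P.marked + P.rest⟩

/-- `Q` is `P`, except that some occurrences of variables of basic type may have been replaced by
new variables `N`, together with the constraints that equate the new variables with the old ones.
(This is how clauses are brought into a form where no variable of basic type occurs twice in an
atom.) -/
def MClause.Delegates (P Q : MClause S) : Prop :=
  ∃ (N : List (Var S)) (ρ : Ty S.Adt → ℕ → ℕ),
    (∀ n ∈ N, n.1.Basic ∧ n ∉ P.toClause.vars ∧ (n.1, ρ n.1 n.2) ∉ N) ∧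
    (∀ τ x, (τ, x) ∉ N → ρ τ x = x) ∧
    Q.head.map (Atom.subst (Subst.ofNames ρ)) = P.head ∧
    Q.con = .and P.con (Cstr.eqAll ρ N) ∧
    Conj.subst (Subst.ofNames ρ) Q.marked = P.marked ∧
    Conj.subst (Subst.ofNames ρ) Q.rest = P.rest

/-- `D'` is a variant of `D` with head `K` and without variables in common with `C`. -/
def RenamedApart (C D D' : Clause S) (K : Atom S) : Prop :=
  D'.IsVariant D ∧ Disjoint D'.vars C.vars ∧ D'.head = some K

/-- `θ` is a most general unifier of the two atoms. -/
def IsMgu (A K : Atom S) (θ : Subst S) : Prop :=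
  IsMostGeneral (fun σ => A.subst σ = K.subst σ) θ

/-- The clause obtained from a clause with head and constraint of `P` and with the marked
atoms `T` and the other atoms `L` (and the selected atom) in its body, by unfolding with the
clause `D'` and the unifier `θ`: the atoms derived from the selected atom are not marked, the
inherited ones keep their marking. -/
def unfoldedClause (P : MClause S) (T L : Conj S) (D' : Clause S) (θ : Subst S) : MClause S :=
  ⟨P.head.map (Atom.subst θ), (Cstr.and P.con D'.con).subst θ, Conj.subst θ T,
    Conj.subst θ (L + D'.body)⟩

/-- `Q` is a set of clauses that results from unfolding `P` with respect to its body atom `A`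
using the clauses `Ds`, where `T` and `L` are the other body atoms of `P`, marked and not
marked.  There is a resulting clause for every clause of `Ds` whose head unifies with `A` by a
most general unifier for which the constraint is satisfiable, and there are no other ones. -/
def IsUnfolding (Ds : Set (Clause S)) (P : MClause S) (A : Atom S) (T L : Conj S)
    (Q : Set (MClause S)) : Prop :=
  (∀ q ∈ Q, ∃ D ∈ Ds, ∃ D' K θ, RenamedApart P.toClause D D' K ∧ IsMgu A K θ ∧
    ((Cstr.and P.con D'.con).subst θ).Sat ∧ (unfoldedClause P T L D' θ).Delegates q) ∧
  (∀ D ∈ Ds, ∃ D' K, RenamedApart P.toClause D D' K ∧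
    ((∃ σ : Subst S, A.subst σ = K.subst σ) →
      ∃ θ, IsMgu A K θ ∧
        (((Cstr.and P.con D'.con).subst θ).Sat → ∃ q ∈ Q, (unfoldedClause P T L D' θ).Delegates q)))

/-- The atom `A` in the body of `C` is a head-instance with respect to `Ds`. -/
def HeadInstance (m : Mode S) (Ds : Set (Clause S)) (C : Clause S) (A : Atom S) : Prop :=
  ∀ D ∈ Ds, ∀ D' K θ, RenamedApart C D D' K → IsMgu A K θ →
    ((Cstr.and C.con D'.con).subst θ).Sat →
    (∀ x ∈ m.inVars A, ∃ y, θ x.1 x.2 = .var x.1 y) ∧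
    (∀ τ x y, (τ, x) ∈ m.inVars A → (τ, y) ∈ m.inVars A → θ τ x = θ τ y → x = y)

/-- `p` depends on `q` in `Ds`. -/
def DependsOn (Ds : Set (Clause S)) : S.Pred → S.Pred → Prop :=
  Relation.TransGen fun p q =>
    ∃ C ∈ Ds, (∃ H, C.head = some H ∧ H.pred = p) ∧ ∃ A ∈ C.body, A.pred = q

/-- The predicate `p` is descending in `Ds` with respect to the relation `prec` on tuples of
terms. -/
def Descending (m : Mode S)
    (prec : List ((τ : Ty S.Adt) × Term S τ) → List ((τ : Ty S.Adt) × Term S τ) → Prop)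
    (Ds : Set (Clause S)) (p : S.Pred) : Prop :=
  ∀ C ∈ Ds, ∀ H, C.head = some H → H.pred = p →
    ∀ A ∈ C.body, DependsOn Ds A.pred p → prec (m.inArgs A) (m.inArgs H)

/-- `P` is a marked clause as at the beginning of Phase 1. -/
def InitialMarking (m : Mode S) (l : S.Pred → ℕ) (P : MClause S) : Prop :=
  (∃ H A T, P.head = some H ∧ P.marked = A ::ₘ T ∧ l H.pred = l A.pred ∧
    ∀ A' ∈ T, m.IsSource (P.marked + P.rest) A') ∧
  ∀ x ∈ m.sourceVars (P.marked + P.rest), x ∈ Conj.vars P.marked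

inductive Phase1Step (Ds : Set (Clause S)) : Set (MClause S) → Set (MClause S) → Prop
  | unfold (U : Set (MClause S)) (P : MClause S) (hP : P ∈ U) (A : Atom S) (T : Conj S)
      (hA : P.marked = A ::ₘ T) (Q : Set (MClause S)) (hQ : IsUnfolding Ds P A T P.rest Q) :
      Phase1Step Ds U ((U \ {P}) ∪ Q)

inductive Phase2Step (m : Mode S)
    (prec : List ((τ : Ty S.Adt) × Term S τ) → List ((τ : Ty S.Adt) × Term S τ) → Prop)
    (Ds : Set (Clause S)) : Set (MClause S) → Set (MClause S) → Prop
  | unfoldable (U : Set (MClause S)) (P : MClause S) (hP : P ∈ U) (A : Atom S) (T : Conj S)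
      (hA : P.marked = A ::ₘ T) (hi : HeadInstance m Ds P.toClause A)
      (Q : Set (MClause S)) (hQ : IsUnfolding Ds P A T P.rest Q) :
      Phase2Step m prec Ds U ((U \ {P}) ∪ Q)
  | descending (U : Set (MClause S)) (P : MClause S) (hP : P ∈ U) (A : Atom S) (L : Conj S)
      (hA : P.rest = A ::ₘ L) (hi : HeadInstance m Ds P.toClause A)
      (hd : Descending m prec Ds A.pred)
      (Q : Set (MClause S)) (hQ : IsUnfolding Ds P A P.marked L Q) :
      Phase2Step m prec Ds U ((U \ {P}) ∪ Q)

/-- The procedure Unfold, with inputs `NewDefs`, `Ds` and output `UnfCls`. -/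
def Unfold (m : Mode S) (l : S.Pred → ℕ)
    (prec : List ((τ : Ty S.Adt) × Term S τ) → List ((τ : Ty S.Adt) × Term S τ) → Prop)
    (NewDefs Ds UnfCls : Set (Clause S)) : Prop :=
  ∃ (mark : Clause S → MClause S) (U₁ U₂ : Set (MClause S)),
    (∀ D ∈ NewDefs, (mark D).toClause = D ∧ InitialMarking m l (mark D)) ∧
    Relation.ReflTransGen (Phase1Step Ds) (mark '' NewDefs) U₁ ∧
    (∀ P ∈ U₁, P.marked = 0) ∧
    Relation.ReflTransGen (Phase2Step m prec Ds)
      ((fun P : MClause S => ⟨P.head, P.con, P.marked + P.rest, 0⟩) '' U₁) U₂ ∧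
    (∀ P ∈ U₂, (∀ A ∈ P.marked, ¬ HeadInstance m Ds P.toClause A) ∧
      ∀ A ∈ P.rest, ¬ (HeadInstance m Ds P.toClause A ∧ Descending m prec Ds A.pred)) ∧
    UnfCls = MClause.toClause '' U₂

/-! ### The procedure Replace -/

/-- One application of a rule to the set `R` of clauses. -/
inductive ReplaceStep (Ds : Set (Clause S)) : Set (Clause S) → Set (Clause S) → Prop
  /-- Clause deletion. -/
  | delete (R : Set (Clause S)) (C : Clause S) (hC : C ∈ R) (hc : ¬ C.con.Sat) :
      ReplaceStep Ds R (R \ {C})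
  /-- Functionality: `F(X,Y), F(X,Z)` is replaced by `Y = Z, F(X,Y)`, where `Z` is the tuple of
  distinct variables obtained by renaming `Y` with `ζ`.  The equalities of basic type are
  constraints; those between ADT variables are solved by a most general unifier `θ`. -/
  | functionality (R : Set (Clause S)) (C : Clause S) (hC : C ∈ R) (G F : Conj S)
      (X : Set (Var S)) (Y : List (Var S)) (ζ : Ty S.Adt → ℕ → ℕ)
      (hF : F ≠ 0) (hXY : IsSplit F X {y | y ∈ Y}) (hnd : Y.Nodup)
      (hfix : ∀ τ x, (τ, x) ∉ Y → ζ τ x = x)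
      (hinj : ∀ τ x y, (τ, x) ∈ Y → (τ, y) ∈ Y → ζ τ x = ζ τ y → x = y)
      (hX : ∀ y ∈ Y, (y.1, ζ y.1 y.2) ∉ X)
      (hbody : C.body = G + F + Conj.subst (Subst.ofNames ζ) F)
      (hfun : Functional (leastModel (R ∪ Ds)) F X {y | y ∈ Y})
      (θ : Subst S)
      (hθ : IsMostGeneral
        (fun σ => ∀ y ∈ Y, ¬ y.1.Basic → σ y.1 y.2 = σ y.1 (ζ y.1 y.2)) θ) :
      ReplaceStep Ds R
        (insert (Clause.subst θ ⟨C.head, .and C.con (Cstr.eqAll ζ Y), G + F⟩) (R \ {C}))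
  /-- Totality: `F(X,Y)` is removed. -/
  | totality (R : Set (Clause S)) (C : Clause S) (hC : C ∈ R) (G F : Conj S)
      (X Y : Set (Var S)) (hF : F ≠ 0) (hXY : IsSplit F X Y)
      (hbody : C.body = G + F)
      (hY : Disjoint Y (Clause.vars ⟨C.head, C.con, G⟩))
      (htot : Total (leastModel (R ∪ Ds)) F X) :
      ReplaceStep Ds R (insert ⟨C.head, C.con, G⟩ (R \ {C}))

/-- The procedure Replace, with inputs `UnfCls`, `Ds` and output `RCls`. -/
def Replace (UnfCls Ds RCls : Set (Clause S)) : Prop :=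
  Relation.ReflTransGen (ReplaceStep Ds) UnfCls RCls ∧ ¬ ∃ R, ReplaceStep Ds RCls R

/-! ### The algorithm -/

/-- The variables of the algorithm: `InCls`, `Defs`, `TransfCls`. -/
structure AlgState (S : Sig.{u}) : Type u where
  inCls : Set (Clause S)
  defs : Set (Clause S)
  transfCls : Set (Clause S)

/-- One execution of the body of the main loop. -/
inductive AlgStep (m : Mode S) (l : S.Pred → ℕ)
    (prec : List ((τ : Ty S.Adt) × Term S τ) → List ((τ : Ty S.Adt) × Term S τ) → Prop)
    (Cls : Set (Clause S)) : AlgState S → AlgState S → Prop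
  | iterate (InCls Defs TransfCls NewDefs FldCls UnfCls RCls : Set (Clause S))
      (hne : InCls.Nonempty)
      (hddf : DiffDefineFold m l Cls InCls Defs NewDefs FldCls)
      (hunf : Unfold m l prec NewDefs (definite Cls) UnfCls)
      (hrep : Replace UnfCls (definite Cls) RCls) :
      AlgStep m l prec Cls ⟨InCls, Defs, TransfCls⟩
        ⟨RCls, Defs ∪ NewDefs, TransfCls ∪ FldCls⟩

/-- The algorithm terminates on the input `Cls` (with level mapping `l`) with the output
`TransfCls`. -/
def AlgorithmR (m : Mode S) (l : S.Pred → ℕ)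
    (prec : List ((τ : Ty S.Adt) × Term S τ) → List ((τ : Ty S.Adt) × Term S τ) → Prop)
    (Cls TransfCls : Set (Clause S)) : Prop :=
  ∃ Defs, Relation.ReflTransGen (AlgStep m l prec Cls) ⟨goals Cls, ∅, ∅⟩ ⟨∅, Defs, TransfCls⟩

end CHC

/-! Let `Δ` be the set of all definitions introduced during the run, and let `P` be `definite Cls ∪
Δ`. The witness for satisfiability is the least model of `P`. It satisfies the definite clauses for
free; what has to be excluded is a goal whose body it makes true.

Everything rests on following ground instances. A clause instance "fires" if its constraint and body
hold in the least model of `P`, which stays fixed through all iterations. Each procedure turns a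
firing instance into a firing instance, with the same ground head, of some clause it produces:
folding because a definition's body implies its head (`DefinesIn`), difference predicates because
totality supplies values for the extra variables (`DiffSplit.exists_valuation`), unfolding by
inverting the last step of a proof (`IsUnfolding.exists_fires`), and replacement because
functionality forces the added equations (`ReplaceStep.isUnfolded_and_covers`). So a violated goal
leads to a headless output clause with true body (`covers_output`). This contradicts a model `J` of
the output, provided that the atoms of that body are also true in `J`.

The last point is an induction that needs a measure, since the output clauses may be recursive. The
weight of a ground atom at level `n` is the least number, over its proofs from `P`, of nodes whose
predicate has level `n` and an ADT argument. The measure is the level, then the weight at that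
level. Heads of definitions have basic types and cost nothing, so folding does not increase weight.
The conjunctions exchanged by a difference predicate lie strictly below the level of the head, where
stratification makes their weight zero. Phase 1 of unfolding always unfolds an ADT atom at the level
of the head, which lowers the weight strictly (`Unfold.isUnfolded_and_covers`). Hence every true
atom of a new predicate is the head of a firing output instance whose body atoms have lower level,
or equal level and smaller weight, and `holds_of_isModel` concludes.

The claim on basic types is an invariant: only clauses with basic types are ever moved to the
output. -/

namespace CHC

universe u

variable {S : Sig.{u}}

/-! ### Evaluation and substitution -/

/-- The valuation obtained by evaluating the terms of a substitution. -/
def Subst.evalAt (σ : Subst S) (v : Valuation S) : Valuation S := fun τ x => (σ τ x).eval v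

theorem Term.eval_subst (σ : Subst S) (v : Valuation S) {τ : Ty S.Adt} (t : Term S τ) :
    (t.subst σ).eval v = t.eval (σ.evalAt v) := by
  induction t with
  | var τ x => rfl
  | app f args ih => simp only [Term.subst, Term.eval, ih]

theorem Term.eval_congr {v w : Valuation S} {τ : Ty S.Adt} (t : Term S τ)
    (h : ∀ x ∈ t.vars, v x.1 x.2 = w x.1 x.2) : t.eval v = t.eval w := by
  induction t with
  | var τ x => exact h (τ, x) rfl
  | app f args ih =>
    simp only [Term.eval]
    congr 1
    funext i
    exact ih i fun x hx => h x (Set.mem_iUnion.2 ⟨i, hx⟩)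

theorem Term.vars_basic {τ : Ty S.Adt} (t : Term S τ) (hτ : τ.Basic) :
    ∀ x ∈ t.vars, x.1.Basic := by
  cases t with
  | var τ x => rintro y rfl; exact hτ
  | app f args => exact hτ.elim

theorem LinExp.eval_subst (σ : Subst S) (v : Valuation S) (t : LinExp S) :
    (t.subst σ).eval v = t.eval (σ.evalAt v) := by
  induction t with
  | tm t => simp only [LinExp.subst, LinExp.eval, Term.eval_subst]
  | const n => rfl
  | add s t hs ht => simp only [LinExp.subst, LinExp.eval, hs, ht]
  | smul k t ht => simp only [LinExp.subst, LinExp.eval, ht]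

theorem LinExp.eval_congr {v w : Valuation S} (t : LinExp S)
    (h : ∀ x ∈ t.vars, v x.1 x.2 = w x.1 x.2) : t.eval v = t.eval w := by
  induction t with
  | tm t => simp only [LinExp.eval, Term.eval_congr t h]
  | const n => rfl
  | add s t hs ht =>
    simp only [LinExp.eval, hs fun x hx => h x (Or.inl hx), ht fun x hx => h x (Or.inr hx)]
  | smul k t ht => simp only [LinExp.eval, ht h]

theorem LinExp.vars_basic (t : LinExp S) : ∀ x ∈ t.vars, x.1.Basic := by
  induction t with
  | tm t => exact t.vars_basic trivial
  | const n => exact fun x hx => hx.elim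
  | add s t hs ht => exact fun x hx => hx.elim (hs x) (ht x)
  | smul k t ht => exact ht

theorem Cstr.holds_subst (σ : Subst S) (v : Valuation S) (c : Cstr S) :
    (c.subst σ).Holds v ↔ c.Holds (σ.evalAt v) := by
  induction c with
  | tru => rfl
  | fls => rfl
  | isTrue t => simp only [Cstr.subst, Cstr.Holds, Term.eval_subst]
  | eq s t => simp only [Cstr.subst, Cstr.Holds, LinExp.eval_subst]
  | le s t => simp only [Cstr.subst, Cstr.Holds, LinExp.eval_subst]
  | neg c hc => simp only [Cstr.subst, Cstr.Holds, hc]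
  | and c d hc hd => simp only [Cstr.subst, Cstr.Holds, hc, hd]
  | or c d hc hd => simp only [Cstr.subst, Cstr.Holds, hc, hd]
  | iff c d hc hd => simp only [Cstr.subst, Cstr.Holds, hc, hd]

theorem Cstr.holds_congr {v w : Valuation S} (c : Cstr S)
    (h : ∀ x ∈ c.vars, v x.1 x.2 = w x.1 x.2) : c.Holds v ↔ c.Holds w := by
  induction c with
  | tru => rfl
  | fls => rfl
  | isTrue t => simp only [Cstr.Holds, Term.eval_congr t h]
  | eq s t =>
    simp only [Cstr.Holds, s.eval_congr fun x hx => h x (Or.inl hx),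
      t.eval_congr fun x hx => h x (Or.inr hx)]
  | le s t =>
    simp only [Cstr.Holds, s.eval_congr fun x hx => h x (Or.inl hx),
      t.eval_congr fun x hx => h x (Or.inr hx)]
  | neg c hc => simp only [Cstr.Holds, hc h]
  | and c d hc hd =>
    simp only [Cstr.Holds, hc fun x hx => h x (Or.inl hx), hd fun x hx => h x (Or.inr hx)]
  | or c d hc hd =>
    simp only [Cstr.Holds, hc fun x hx => h x (Or.inl hx), hd fun x hx => h x (Or.inr hx)]
  | iff c d hc hd =>
    simp only [Cstr.Holds, hc fun x hx => h x (Or.inl hx), hd fun x hx => h x (Or.inr hx)]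

theorem Cstr.vars_basic (c : Cstr S) : ∀ x ∈ c.vars, x.1.Basic := by
  induction c with
  | tru => exact fun x hx => hx.elim
  | fls => exact fun x hx => hx.elim
  | isTrue t => exact t.vars_basic trivial
  | eq s t => exact fun x hx => hx.elim (s.vars_basic x) (t.vars_basic x)
  | le s t => exact fun x hx => hx.elim (s.vars_basic x) (t.vars_basic x)
  | neg c hc => exact hc
  | and c d hc hd => exact fun x hx => hx.elim (hc x) (hd x)
  | or c d hc hd => exact fun x hx => hx.elim (hc x) (hd x)
  | iff c d hc hd => exact fun x hx => hx.elim (hc x) (hd x)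

/-- Ground atoms over the fixed domains. -/
abbrev GAtom (S : Sig.{u}) : Type u :=
  (p : S.Pred) × ((i : Fin (S.arity p)) → Val S (S.arg p i))

def Atom.ground (v : Valuation S) (A : Atom S) : GAtom S := ⟨A.pred, fun i => (A.args i).eval v⟩

theorem Atom.holds_iff (I : Interp S) (v : Valuation S) (A : Atom S) :
    A.Holds I v ↔ I (A.ground v).1 (A.ground v).2 := Iff.rfl

theorem Atom.ground_subst (σ : Subst S) (v : Valuation S) (A : Atom S) :
    (A.subst σ).ground v = A.ground (σ.evalAt v) := by
  simp only [Atom.ground, Atom.subst, Term.eval_subst]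

theorem Atom.ground_congr {v w : Valuation S} (A : Atom S)
    (h : ∀ x ∈ A.vars, v x.1 x.2 = w x.1 x.2) : A.ground v = A.ground w := by
  simp only [Atom.ground]
  congr 1
  funext i
  exact (A.args i).eval_congr fun x hx => h x (Set.mem_iUnion.2 ⟨i, hx⟩)

theorem Atom.holds_congr_ground {I : Interp S} {v w : Valuation S} {A B : Atom S}
    (h : A.ground v = B.ground w) : A.Holds I v ↔ B.Holds I w := by
  rw [Atom.holds_iff, h, Atom.holds_iff]

theorem Atom.vars_basic {A : Atom S} (hA : A.HasBasicTypes) : ∀ x ∈ A.vars, x.1.Basic := by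
  intro x hx
  obtain ⟨i, hi⟩ := Set.mem_iUnion.1 hx
  exact (A.args i).vars_basic (hA i) x hi

theorem Conj.holds_add {I : Interp S} {v : Valuation S} {G F : Conj S} :
    Conj.Holds I v (G + F) ↔ Conj.Holds I v G ∧ Conj.Holds I v F := by
  simp only [Conj.Holds, Multiset.mem_add]
  exact ⟨fun h => ⟨fun A hA => h A (Or.inl hA), fun A hA => h A (Or.inr hA)⟩,
    fun h A hA => hA.elim (h.1 A) (h.2 A)⟩

theorem Conj.holds_cons {I : Interp S} {v : Valuation S} {A : Atom S} {F : Conj S} :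
    Conj.Holds I v (A ::ₘ F) ↔ A.Holds I v ∧ Conj.Holds I v F := by
  simp [Conj.Holds]

theorem Conj.holds_subst (I : Interp S) (σ : Subst S) (v : Valuation S) (G : Conj S) :
    Conj.Holds I v (Conj.subst σ G) ↔ Conj.Holds I (σ.evalAt v) G := by
  simp only [Conj.Holds, Conj.subst, Multiset.mem_map, forall_exists_index, and_imp,
    forall_apply_eq_imp_iff₂]
  exact forall₂_congr fun A _ => Atom.holds_congr_ground (A.ground_subst σ v)

theorem Conj.holds_congr (I : Interp S) {v w : Valuation S} (G : Conj S)
    (h : ∀ x ∈ Conj.vars G, v x.1 x.2 = w x.1 x.2) : Conj.Holds I v G ↔ Conj.Holds I w G :=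
  forall₂_congr fun A hA =>
    Atom.holds_congr_ground (A.ground_congr fun x hx => h x ⟨A, hA, hx⟩)

theorem Conj.holds_mono {I J : Interp S} (hIJ : ∀ p a, I p a → J p a) {v : Valuation S}
    {G : Conj S} (h : Conj.Holds I v G) : Conj.Holds J v G :=
  fun A hA => hIJ _ _ (h A hA)

/-! ### Values as terms -/

/-- A value as a term; integers and truth values are coded by variables. -/
def Val.toTerm : {τ : Ty S.Adt} → Val S τ → Term S τ
  | _, .int n => .var .int (Encodable.encode n)
  | _, .bool b => .var .bool (Encodable.encode b)
  | _, .app f args => .app f fun i => (args i).toTerm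

/-- The valuation that decodes the variables standing for basic values. -/
def Valuation.decode (u : Valuation S) : Valuation S
  | .int, x => .int ((Encodable.decode x : Option ℤ).getD 0)
  | .bool, x => .bool ((Encodable.decode x : Option Bool).getD false)
  -- Coded values contain no ADT variables, so any element would do here; `u` merely supplies one.
  | .adt a, x => u (.adt a) x

theorem Val.eval_toTerm (u : Valuation S) {τ : Ty S.Adt} (a : Val S τ) :
    a.toTerm.eval u.decode = a := by
  induction a with
  | int n =>
    change Val.int ((Encodable.decode (Encodable.encode n) : Option ℤ).getD 0) = _
    rw [Encodable.encodek]
    rfl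
  | bool b =>
    change Val.bool ((Encodable.decode (Encodable.encode b) : Option Bool).getD false) = _
    rw [Encodable.encodek]
    rfl
  | app f args ih => simp only [Val.toTerm, Term.eval, ih]

/-- A valuation as a substitution. -/
def Valuation.toSubst (u : Valuation S) : Subst S := fun τ x => (u τ x).toTerm

theorem Term.subst_toSubst (u : Valuation S) {τ : Ty S.Adt} (t : Term S τ) :
    t.subst u.toSubst = (t.eval u).toTerm := by
  induction t with
  | var τ x => rfl
  | app f args ih => simp only [Term.subst, Term.eval, Val.toTerm, ih]

/-- Coding values as terms turns a semantic coincidence of ground instances into a syntactic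
unifier, to which the generality of a most general unifier applies. -/
theorem Atom.subst_toSubst_eq {u : Valuation S} {A K : Atom S} (h : A.ground u = K.ground u) :
    A.subst u.toSubst = K.subst u.toSubst := by
  have key : ∀ B : Atom S, B.subst u.toSubst =
      ⟨(B.ground u).1, fun i => ((B.ground u).2 i).toTerm⟩ := by
    intro B
    simp only [Atom.subst, Atom.ground, Term.subst_toSubst]
  rw [key A, key K, h]

/-- A valuation that solves a unification problem factors through every most general unifier. -/
theorem IsMostGeneral.exists_evalAt_eq {U : Subst S → Prop} {θ : Subst S}
    (hθ : IsMostGeneral U θ) (u : Valuation S) (hu : U u.toSubst) :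
    ∃ v : Valuation S, θ.evalAt v = u := by
  obtain ⟨γ, hγ⟩ := hθ.2 _ hu
  -- Evaluating both sides of `u.toSubst = θ.comp γ` under `u.decode` undoes the coding on the left.
  refine ⟨γ.evalAt u.decode, ?_⟩
  funext τ x
  have h := congrArg (fun σ : Subst S => (σ τ x).eval u.decode) hγ
  simp only [Subst.comp, Term.eval_subst, Valuation.toSubst, Val.eval_toTerm] at h
  exact h.symm

/-- A renaming is a permutation, so valuations can be carried from a clause to its variant and back.
-/
theorem Clause.IsVariant.exists_inverse {C D : Clause S} (h : C.IsVariant D) :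
    ∃ σ τ : Subst S, C = D.subst σ ∧ (∀ v, τ.evalAt (σ.evalAt v) = v) ∧
      ∀ v, σ.evalAt (τ.evalAt v) = v := by
  obtain ⟨ρ, rfl⟩ := h
  refine ⟨_, Subst.ofNames fun τ x => (ρ τ).symm x, rfl, fun v => ?_, fun v => ?_⟩ <;>
  · funext τ x
    simp [Subst.evalAt, Subst.ofNames, Term.eval]

/-! ### Derivations and weights -/

open Classical in
/-- The contribution to the weight at level `n` of one node labelled with the predicate `p`: only
predicates of level `n` with an ADT argument count. -/
noncomputable def nodeWeight (l : S.Pred → ℕ) (n : WithTop ℕ) (p : S.Pred) : ℕ :=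
  if (l p : WithTop ℕ) = n ∧ ∃ i, ¬ (S.arg p i).Basic then 1 else 0

/-- `Der P l n g k`: there is a proof of the ground atom `g` from the clauses `P` that has weight
`k` at level `n`. -/
inductive Der (P : Set (Clause S)) (l : S.Pred → ℕ) (n : WithTop ℕ) : GAtom S → ℕ → Prop
  | node (C : Clause S) (hC : C ∈ P) (H : Atom S) (hH : C.head = some H) (v : Valuation S)
      (hv : C.con.Holds v) (wt : Atom S → ℕ) (h : ∀ A ∈ C.body, Der P l n (A.ground v) (wt A)) :
      Der P l n (H.ground v) ((C.body.map wt).sum + nodeWeight l n H.pred)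

/-- The minimal weight of a proof of a ground atom. -/
noncomputable def GAtom.weight (P : Set (Clause S)) (l : S.Pred → ℕ) (n : WithTop ℕ)
    (g : GAtom S) : ℕ := sInf {k | Der P l n g k}

noncomputable def Conj.weight (P : Set (Clause S)) (l : S.Pred → ℕ) (n : WithTop ℕ)
    (v : Valuation S) (G : Conj S) : ℕ := (G.map fun A => GAtom.weight P l n (A.ground v)).sum

section Weights

variable {P : Set (Clause S)} {l : S.Pred → ℕ} {n : WithTop ℕ}

theorem Conj.weight_add (v : Valuation S) (G F : Conj S) :
    Conj.weight P l n v (G + F) = Conj.weight P l n v G + Conj.weight P l n v F := by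
  simp [Conj.weight]

theorem Conj.weight_cons (v : Valuation S) (A : Atom S) (F : Conj S) :
    Conj.weight P l n v (A ::ₘ F) = (A.ground v).weight P l n + Conj.weight P l n v F := by
  simp [Conj.weight]

theorem Conj.weight_subst (σ : Subst S) (v : Valuation S) (G : Conj S) :
    Conj.weight P l n v (Conj.subst σ G) = Conj.weight P l n (σ.evalAt v) G := by
  simp only [Conj.weight, Conj.subst, Multiset.map_map, Function.comp_def, Atom.ground_subst]

theorem Conj.weight_congr {v w : Valuation S} (G : Conj S)
    (h : ∀ x ∈ Conj.vars G, v x.1 x.2 = w x.1 x.2) :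
    Conj.weight P l n v G = Conj.weight P l n w G := by
  unfold Conj.weight
  congr 1
  refine Multiset.map_congr rfl fun A hA => ?_
  rw [A.ground_congr fun x hx => h x ⟨A, hA, hx⟩]

theorem Conj.weight_mem_le {v : Valuation S} {G : Conj S} {A : Atom S} (hA : A ∈ G) :
    (A.ground v).weight P l n ≤ Conj.weight P l n v G :=
  Multiset.single_le_sum (fun _ _ => Nat.zero_le _) _ (Multiset.mem_map_of_mem _ hA)

theorem leastModel_mono {P Q : Set (Clause S)} (h : P ⊆ Q) (p : S.Pred) (a) :
    leastModel P p a → leastModel Q p a :=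
  fun hp I hI => hp I fun C hC => hI C (h hC)

theorem Der.leastModel {g : GAtom S} {k : ℕ} (h : Der P l n g k) :
    leastModel P g.1 g.2 := by
  induction h with
  | node C hC H hH v hv wt _ ih =>
    intro I hI
    obtain ⟨H', hH', hh⟩ := hI C hC v hv fun A hA => ih A hA I hI
    rw [hH] at hH'
    cases hH'
    exact hh

/-- The provable ground atoms form a model of the program, so the least model is contained in them.
-/
theorem exists_der (hP : ∀ C ∈ P, C.head ≠ none) (l : S.Pred → ℕ) (n : WithTop ℕ) {g : GAtom S}
    (h : leastModel P g.1 g.2) : ∃ k, Der P l n g k := by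
  refine h (fun p a => ∃ k, Der P l n ⟨p, a⟩ k) ?_
  intro C hC v hv hb
  obtain ⟨H, hH⟩ := Option.ne_none_iff_exists'.1 (hP C hC)
  have hb' : ∀ A : Atom S, ∃ k, A ∈ C.body → Der P l n (A.ground v) k := by
    intro A
    by_cases hA : A ∈ C.body
    · obtain ⟨k, hk⟩ := hb A hA
      exact ⟨k, fun _ => hk⟩
    · exact ⟨0, fun h => absurd h hA⟩
  choose wt hwt using hb'
  exact ⟨H, hH, _, Der.node C hC H hH v hv wt hwt⟩

theorem der_weight (hP : ∀ C ∈ P, C.head ≠ none) {g : GAtom S} (h : leastModel P g.1 g.2) :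
    Der P l n g (g.weight P l n) :=
  Nat.sInf_mem (s := {k | Der P l n g k}) (exists_der hP l n h)

/-- Minimal proofs of the body atoms combine into one proof of the head, not necessarily a minimal
one. -/
theorem leastModel_head (hP : ∀ C ∈ P, C.head ≠ none) {C : Clause S} (hC : C ∈ P) {H : Atom S}
    (hH : C.head = some H) {v : Valuation S} (hv : C.con.Holds v)
    (hb : Conj.Holds (leastModel P) v C.body) :
    H.Holds (leastModel P) v ∧
      (H.ground v).weight P l n ≤ Conj.weight P l n v C.body + nodeWeight l n H.pred := by
  have hd : Der P l n (H.ground v) (Conj.weight P l n v C.body + nodeWeight l n H.pred) :=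
    Der.node C hC H hH v hv _ fun A hA => der_weight hP (hb A hA)
  exact ⟨hd.leastModel, Nat.sInf_le hd⟩

/-- Inspect the last clause of a proof of minimal weight: its subproofs weigh at least as much as
minimal proofs of the body atoms. -/
theorem leastModel_inversion (hP : ∀ C ∈ P, C.head ≠ none) (l : S.Pred → ℕ) (n : WithTop ℕ)
    {g : GAtom S} (h : leastModel P g.1 g.2) :
    ∃ C ∈ P, ∃ H, C.head = some H ∧ ∃ v : Valuation S, H.ground v = g ∧ C.con.Holds v ∧
      Conj.Holds (leastModel P) v C.body ∧
      Conj.weight P l n v C.body + nodeWeight l n g.1 ≤ g.weight P l n := by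
  have hd := der_weight (l := l) (n := n) hP h
  generalize hk : g.weight P l n = k at hd
  cases hd with
  | node C hC H hH v hv wt hwt =>
    refine ⟨C, hC, H, hH, v, rfl, hv, fun A hA => (hwt A hA).leastModel, ?_⟩
    refine Nat.add_le_add_right (Multiset.sum_map_le_sum_map _ _ fun A hA => ?_) _
    exact Nat.sInf_le (hwt A hA)

theorem isModel_leastModel (hP : ∀ C ∈ P, C.head ≠ none) : IsModel (leastModel P) P := by
  intro C hC v hv hb
  obtain ⟨H, hH⟩ := Option.ne_none_iff_exists'.1 (hP C hC)
  exact ⟨H, hH, (leastModel_head (l := fun _ => 0) (n := 0) hP hC hH hv hb).1⟩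

/-- By stratification levels never increase from a node to its children, so a proof of an atom below
level `n` has no node at level `n`. -/
theorem Der.eq_zero (hs : Stratified l P) {g : GAtom S} {k : ℕ} (h : Der P l n g k)
    (hg : (l g.1 : WithTop ℕ) < n) : k = 0 := by
  induction h with
  | node C hC H hH v hv wt _ ih =>
    have h0 : nodeWeight l n H.pred = 0 := if_neg fun h => hg.ne h.1
    rw [h0, add_zero, Multiset.sum_eq_zero_iff]
    intro k hk
    obtain ⟨A, hA, rfl⟩ := Multiset.mem_map.1 hk
    refine ih A hA (lt_of_le_of_lt ?_ hg)
    have := hs C hC A hA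
    rw [hH] at this
    exact this

theorem GAtom.weight_eq_zero (hs : Stratified l P) {g : GAtom S}
    (hg : (l g.1 : WithTop ℕ) < n) : g.weight P l n = 0 := by
  by_cases h : ∃ k, Der P l n g k
  · exact (Nat.sInf_mem (s := {k | Der P l n g k}) h).eq_zero hs hg
  -- An atom without a proof gets weight zero from the convention `sInf ∅ = 0`.
  · have : {k | Der P l n g k} = ∅ := Set.eq_empty_iff_forall_notMem.2 fun k hk => h ⟨k, hk⟩
    rw [GAtom.weight, this, Nat.sInf_empty]

theorem Conj.weight_eq_zero (hs : Stratified l P) {v : Valuation S} {G : Conj S}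
    (hG : ∀ A ∈ G, (l A.pred : WithTop ℕ) < n) : Conj.weight P l n v G = 0 := by
  rw [Conj.weight, Multiset.sum_eq_zero_iff]
  intro k hk
  obtain ⟨A, hA, rfl⟩ := Multiset.mem_map.1 hk
  exact GAtom.weight_eq_zero hs (hG A hA)

end Weights

/-! ### Firing clauses -/

/-- The level of a ground head. -/
def groundLevel (l : S.Pred → ℕ) : Option (GAtom S) → WithTop ℕ
  | none => ⊤
  | some g => (l g.1 : WithTop ℕ)

/-- The instance of `C` given by `v` has the head `h` and a body that is true in the least model
of `P`, and of weight at most `w` at the level of the head. -/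
structure Clause.Fires (P : Set (Clause S)) (l : S.Pred → ℕ) (h : Option (GAtom S)) (w : ℕ)
    (C : Clause S) (v : Valuation S) : Prop where
  head : C.head.map (Atom.ground v) = h
  con : C.con.Holds v
  body : Conj.Holds (leastModel P) v C.body
  weight : Conj.weight P l (groundLevel l h) v C.body ≤ w

theorem groundLevel_map (l : S.Pred → ℕ) (v : Valuation S) (H : Option (Atom S)) :
    groundLevel l (H.map (Atom.ground v)) = headLevel l H := by
  cases H <;> rfl

/-- Some instance of a clause of `R` fires. -/
def Covers (P : Set (Clause S)) (l : S.Pred → ℕ) (R : Set (Clause S)) (h : Option (GAtom S))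
    (w : ℕ) : Prop := ∃ C ∈ R, ∃ v, C.Fires P l h w v

theorem Covers.mono {P : Set (Clause S)} {l : S.Pred → ℕ} {R R' : Set (Clause S)}
    {h : Option (GAtom S)} {w : ℕ} (hc : Covers P l R h w) (hR : R ⊆ R') : Covers P l R' h w :=
  let ⟨C, hC, v, hv⟩ := hc; ⟨C, hR hC, v, hv⟩

/-! ### Definitions -/

/-- `D` defines a new predicate with arguments of basic types by atoms with ADT arguments. -/
def IsDefinition (l : S.Pred → ℕ) (Cls : Set (Clause S)) (D : Clause S) : Prop :=
  (∃ K, D.head = some K ∧ K.HasBasicTypes ∧ (∀ C ∈ Cls, ¬ C.Mentions K.pred) ∧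
    l K.pred = maxLevel l D.body) ∧ ∀ A ∈ D.body, ¬ A.HasBasicTypes

theorem le_maxLevel {l : S.Pred → ℕ} {G : Conj S} {A : Atom S} (hA : A ∈ G) :
    l A.pred ≤ maxLevel l G :=
  Multiset.le_sup (Multiset.mem_map_of_mem (fun A : Atom S => l A.pred) hA)

theorem maxLevel_le {l : S.Pred → ℕ} {G : Conj S} {n : WithTop ℕ}
    (h : ∀ A ∈ G, (l A.pred : WithTop ℕ) ≤ n) : (maxLevel l G : WithTop ℕ) ≤ n := by
  cases n with
  | top => exact le_top
  | coe n =>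
    refine WithTop.coe_le_coe.2 (Multiset.sup_le.2 fun k hk => ?_)
    obtain ⟨A, hA, rfl⟩ := Multiset.mem_map.1 hk
    exact WithTop.coe_le_coe.1 (h A hA)

theorem maxLevel_subst (l : S.Pred → ℕ) (σ : Subst S) (G : Conj S) :
    maxLevel l (Conj.subst σ G) = maxLevel l G := by
  simp only [maxLevel, Conj.subst, Multiset.map_map, Function.comp_def, Atom.subst]

theorem IsDefinition.variant {l : S.Pred → ℕ} {Cls : Set (Clause S)} {D D' : Clause S}
    (h : IsDefinition l Cls D) (hv : D'.IsVariant D) : IsDefinition l Cls D' := by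
  obtain ⟨⟨K, hK, hb, hm, hl⟩, hB⟩ := h
  obtain ⟨ρ, rfl⟩ := hv
  refine ⟨⟨K.subst _, by rw [Clause.subst, hK]; rfl, hb, hm, ?_⟩, ?_⟩
  · rw [Clause.subst, maxLevel_subst]; exact hl
  · intro A hA
    obtain ⟨A', hA', rfl⟩ := Multiset.mem_map.1 hA
    exact hB A' hA'

theorem IsNewHead.isDefinition {l : S.Pred → ℕ} {Cls Old : Set (Clause S)} {K : Atom S}
    {U : Set (Var S)} {B : Conj S} (h : IsNewHead l Old K U B) (hO : Cls ⊆ Old)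
    (hB : ∀ A ∈ B, ¬ A.HasBasicTypes) (c : Cstr S) : IsDefinition l Cls ⟨some K, c, B⟩ :=
  ⟨⟨K, rfl, h.1.1, fun C hC => h.2.1 C (hO hC), h.2.2⟩, hB⟩

/-- The predicate is not the head predicate of a clause of `Δ`. -/
def NotDefinedIn (Δ : Set (Clause S)) (p : S.Pred) : Prop :=
  ∀ D ∈ Δ, ∀ K, D.head = some K → K.pred ≠ p

section

variable {l : S.Pred → ℕ} {Cls Δ : Set (Clause S)}

theorem notDefinedIn_of_mentions (hΔ : ∀ D ∈ Δ, IsDefinition l Cls D) {C : Clause S}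
    (hC : C ∈ Cls) {p : S.Pred} (hp : C.Mentions p) : NotDefinedIn Δ p := by
  rintro D hD K hK rfl
  obtain ⟨⟨K', hK', -, hm, -⟩, -⟩ := hΔ D hD
  rw [hK] at hK'
  cases hK'
  exact hm C hC hp

theorem notDefinedIn_of_not_hasBasicTypes (hΔ : ∀ D ∈ Δ, IsDefinition l Cls D) {A : Atom S}
    (hA : ¬ A.HasBasicTypes) : NotDefinedIn Δ A.pred := by
  intro D hD K hK h
  obtain ⟨⟨K', hK', hb, -⟩, -⟩ := hΔ D hD
  rw [hK] at hK'
  cases hK'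
  refine hA ?_
  have : ∀ p q : S.Pred, p = q → (∀ i, (S.arg p i).Basic) → ∀ i, (S.arg q i).Basic := by
    rintro p q rfl h
    exact h
  exact this _ _ h hb

theorem head_ne_none_of_mem (hΔ : ∀ D ∈ Δ, IsDefinition l Cls D) :
    ∀ C ∈ definite Cls ∪ Δ, C.head ≠ none := by
  rintro C (hC | hC)
  · exact hC.2
  · obtain ⟨⟨K, hK, -⟩, -⟩ := hΔ C hC
    simp [hK]

theorem stratified_program (hs : Stratified l Cls) (hΔ : ∀ D ∈ Δ, IsDefinition l Cls D) :
    Stratified l (definite Cls ∪ Δ) := by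
  rintro C (hC | hC) A hA
  · exact hs C hC.1 A hA
  · obtain ⟨⟨K, hK, -, -, hl⟩, -⟩ := hΔ C hC
    rw [hK]
    exact WithTop.coe_le_coe.2 (hl ▸ le_maxLevel hA)

/-- Definitions are a conservative extension, since the clauses of `Cls` do not mention the new
predicates. This makes truth in the least model of the whole program usable where functionality
refers to another one. -/
theorem leastModel_definite (hΔ : ∀ D ∈ Δ, IsDefinition l Cls D) {p : S.Pred}
    (hp : NotDefinedIn Δ p) {a} (h : leastModel (definite Cls ∪ Δ) p a) :
    leastModel (definite Cls) p a := by
  -- The test interpretation makes every atom of a defined predicate true, so the definitions hold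
  -- in it trivially.
  refine h (fun p a => NotDefinedIn Δ p → leastModel (definite Cls) p a) ?_ hp
  rintro C (hC | hC) v hv hb
  · obtain ⟨H, hH, hh⟩ := isModel_leastModel (fun C hC => hC.2) C hC v hv fun A hA =>
      hb A hA (notDefinedIn_of_mentions hΔ hC.1 (Or.inr ⟨A, hA, rfl⟩))
    exact ⟨H, hH, fun _ => hh⟩
  · obtain ⟨⟨K, hK, -⟩, -⟩ := hΔ C hC
    exact ⟨K, hK, fun h => absurd rfl (h C hC K hK)⟩

/-- This is why weight counts only predicates with an ADT argument: passing from a definition's body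
to its head is free. -/
theorem nodeWeight_eq_zero {K : Atom S} (hK : K.HasBasicTypes) (n : WithTop ℕ) :
    nodeWeight l n K.pred = 0 :=
  if_neg fun ⟨_, i, hi⟩ => hi (hK i)

/-- `K ← c, B` holds in the least model of `P`, and `K` weighs at most as much as `B`. -/
def DefinesIn (P : Set (Clause S)) (l : S.Pred → ℕ) (K : Atom S) (c : Cstr S) (B : Conj S) :
    Prop :=
  ∀ v : Valuation S, c.Holds v → Conj.Holds (leastModel P) v B → K.Holds (leastModel P) v ∧
    ∀ n, (K.ground v).weight P l n ≤ Conj.weight P l n v B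

theorem definesIn_of_mem (hΔ : ∀ D ∈ Δ, IsDefinition l Cls D) {D : Clause S} (hD : D ∈ Δ)
    {K : Atom S} (hK : D.head = some K) :
    DefinesIn (definite Cls ∪ Δ) l K D.con D.body := by
  intro v hv hb
  obtain ⟨⟨K', hK', hKb, -⟩, -⟩ := hΔ D hD
  rw [hK] at hK'
  cases hK'
  have h := fun n => leastModel_head (l := l) (n := n) (head_ne_none_of_mem hΔ) (Or.inr hD) hK
    hv hb
  refine ⟨(h 0).1, fun n => ?_⟩
  have := (h n).2
  rwa [nodeWeight_eq_zero hKb, add_zero] at this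

theorem definesIn_of_isDefVariant (hΔ : ∀ D ∈ Δ, IsDefinition l Cls D) {Δ' : Set (Clause S)}
    (hΔ' : Δ' ⊆ Δ) {D : Clause S} {K : Atom S} (hD : IsDefVariant Δ' D K) :
    DefinesIn (definite Cls ∪ Δ) l K D.con D.body := by
  obtain ⟨⟨D₀, hD₀, ρ, rfl⟩, hK, -⟩ := hD
  obtain ⟨⟨K₀, hK₀, -⟩, -⟩ := hΔ D₀ (hΔ' hD₀)
  simp only [Clause.subst, hK₀, Option.map_some, Option.some.injEq] at hK
  subst hK
  intro v hv hb
  simp only [Clause.subst] at hv hb ⊢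
  rw [Cstr.holds_subst] at hv
  rw [Conj.holds_subst] at hb
  have h := definesIn_of_mem hΔ (hΔ' hD₀) hK₀ _ hv hb
  rw [Atom.holds_iff, Atom.ground_subst]
  refine ⟨h.1, fun n => ?_⟩
  rw [Conj.weight_subst]
  exact h.2 n

theorem Subst.ActsOnlyOn.evalAt_eq {θ : Subst S} {G : Conj S}
    (hθ : θ.ActsOnlyOn (Conj.adtVars G)) (v : Valuation S) (x : Var S) (hx : x.1.Basic) :
    θ.evalAt v x.1 x.2 = v x.1 x.2 := by
  rw [Subst.evalAt, hθ x.1 x.2 fun h => h.2 hx]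
  rfl

/-- Replacing the ADT variables in the body of a definition does not affect the head. -/
theorem DefinesIn.instance {P : Set (Clause S)} {K : Atom S} {c : Cstr S} {B : Conj S}
    (h : DefinesIn P l K c B) (hK : K.HasBasicTypes) {θ : Subst S}
    (hθ : θ.ActsOnlyOn (Conj.adtVars B)) : DefinesIn P l K c (Conj.subst θ B) := by
  intro v hv hb
  have hv' : c.Holds (θ.evalAt v) :=
    (c.holds_congr fun x hx => (hθ.evalAt_eq v x (c.vars_basic x hx))).2 hv
  have hg : K.ground (θ.evalAt v) = K.ground v :=
    K.ground_congr fun x hx => hθ.evalAt_eq v x (K.vars_basic hK x hx)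
  rw [Conj.holds_subst] at hb
  obtain ⟨h1, h2⟩ := h _ hv' hb
  rw [Atom.holds_iff, ← hg]
  refine ⟨h1, fun n => ?_⟩
  rw [Conj.weight_subst]
  exact h2 n

end

/-! ### Sharing blocks -/

theorem Atom.not_hasBasicTypes_of_adtVars {A : Atom S} (h : A.adtVars.Nonempty) :
    ¬ A.HasBasicTypes :=
  fun hA => let ⟨x, hx, hb⟩ := h; hb (Atom.vars_basic hA x hx)

/-- A nontrivial chain starts and ends with a shared ADT variable. -/
theorem Conj.Linked.eq_or_adtVars {G : Conj S} {A A' : Atom S} (h : Conj.Linked G A A') :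
    A = A' ∨ (A.adtVars.Nonempty ∧ A'.adtVars.Nonempty) := by
  induction h with
  | refl => exact Or.inl rfl
  | tail _ hs ih =>
    obtain ⟨-, -, x, hx, hx'⟩ := hs
    rcases ih with rfl | ih
    · exact Or.inr ⟨⟨x, hx⟩, ⟨x, hx'⟩⟩
    · exact Or.inr ⟨ih.1, ⟨x, hx'⟩⟩

/-- One atom with an ADT argument suffices: distinct atoms of a block are linked, so all of them
contain ADT variables. Hence the bodies of definitions consist of atoms that can contribute to
weight. -/
theorem Selected.not_hasBasicTypes {C : Clause S} {B G' : Conj S} (h : Selected C B G') :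
    ∀ A ∈ B, ¬ A.HasBasicTypes := by
  obtain ⟨-, ⟨A₀, hA₀, hl, -⟩, A₁, hA₁, hb₁⟩ := h
  have hb₀ : ¬ A₀.HasBasicTypes := by
    rcases (hl A₁ hA₁).eq_or_adtVars with rfl | h
    · exact hb₁
    · exact Atom.not_hasBasicTypes_of_adtVars h.1
  intro A hA
  rcases (hl A hA).eq_or_adtVars with rfl | h
  · exact hb₀
  · exact Atom.not_hasBasicTypes_of_adtVars h.2

/-! ### Difference predicates -/

theorem Conj.AtomwiseSubsumes.map_pred_le {G G' : Conj S} (h : Conj.AtomwiseSubsumes G G') :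
    G.map Atom.pred ≤ G'.map Atom.pred := by
  obtain ⟨G₁, hG₁, hr⟩ := h
  refine le_trans (le_of_eq ?_) (Multiset.map_le_map hG₁)
  rw [← Multiset.rel_eq, Multiset.rel_map]
  exact hr.mono fun A _ B _ ⟨θ, hθ⟩ => hθ ▸ rfl

section

variable {l : S.Pred → ℕ} {Cls : Set (Clause S)}

/-- Substitution keeps predicates, so as multisets the predicates of `M + R` lie in those of `M +
F`, and `M` cancels. The atoms of `R` thus inherit the strict level bound imposed on `F`. -/
theorem exists_pred_eq_of_split {B G M F R : Conj S} {θ : Subst S}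
    (hsub : Conj.AtomwiseSubsumes G B) (hB : B = M + F) (hG : Conj.subst θ G = M + R) :
    ∀ A ∈ R, ∃ A' ∈ F, A'.pred = A.pred := by
  have h := hsub.map_pred_le
  have hG' : G.map Atom.pred = (M + R).map Atom.pred := by
    rw [← hG, Conj.subst, Multiset.map_map]
    rfl
  rw [hG', hB, Multiset.map_add, Multiset.map_add, add_le_add_iff_left] at h
  intro A hA
  exact Multiset.mem_map.1 (Multiset.mem_of_le h (Multiset.mem_map_of_mem _ hA))

/-- The difference predicate and the definition used for the folding hold together with the
body of the clause, after a change of values of variables that do not occur in the clause. -/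
theorem DiffSplit.exists_valuation {P Q : Set (Clause S)} {C : Clause S} {B G' : Conj S}
    {D : Clause S} {M F R : Conj S} {X Y V W : Set (Var S)}
    (hs : DiffSplit l (leastModel Q) C B D M F R X Y V W) (hQ : Q ⊆ P)
    (hP : Stratified l P)
    (hB : C.body = B + G') (hsub : Conj.AtomwiseSubsumes D.body B)
    {π : Cstr S} (hπ : C.con.Entails π) {diff : Atom S} (hdiff : DefinesIn P l diff π (F + R))
    {K : Atom S} (hKb : K.HasBasicTypes) {a : Cstr S} (hK : DefinesIn P l K a D.body)
    (ha : C.con.Entails a) {h : Option (GAtom S)} {w : ℕ} {v : Valuation S}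
    (hv : C.Fires P l h w v) :
    ∃ v', Clause.Fires P l h w ⟨C.head, C.con, K ::ₘ diff ::ₘ G'⟩ v' := by
  classical
  obtain ⟨-, ⟨hMF, -, -⟩, ⟨⟨θ, hθ, hMR⟩, ⟨⟨hVW, hvars⟩, -, htot⟩, hW⟩, hF⟩ := hs
  obtain ⟨w₀, hw₀, hR⟩ := htot v
  -- Only the variables in `W` take the values given by totality; they do not occur in `C`, so its
  -- instance is unchanged.
  let v' : Valuation S := fun τ x => if (τ, x) ∈ W then w₀ τ x else v τ x
  have hC : ∀ x ∈ C.vars, v x.1 x.2 = v' x.1 x.2 := fun x hx =>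
    (if_neg fun h => Set.disjoint_left.1 hW h hx).symm
  have hCb : ∀ x ∈ Conj.vars C.body, v x.1 x.2 = v' x.1 x.2 := fun x hx => hC x (Or.inr hx)
  have hRv : ∀ x ∈ Conj.vars R, w₀ x.1 x.2 = v' x.1 x.2 := by
    intro x hx
    by_cases hxW : x ∈ W
    · exact (if_pos hxW).symm
    · rw [← hvars] at hx
      exact (hw₀ x (hx.resolve_right hxW)).trans (if_neg hxW).symm
  have hbody : Conj.Holds (leastModel P) v' C.body := (Conj.holds_congr _ _ hCb).1 hv.body
  have hcon : C.con.Holds v' :=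
    (C.con.holds_congr fun x hx => hC x (Or.inl (Or.inr hx))).1 hv.con
  -- Totality was established in the least model of an earlier program; the existence of true
  -- instances persists as definitions are added.
  have hR' : Conj.Holds (leastModel P) v' R :=
    (Conj.holds_congr _ _ hRv).1 (Conj.holds_mono (leastModel_mono hQ) hR)
  have hwt := hv.weight
  rw [Conj.weight_congr C.body hCb, hB, Conj.weight_add, hMF, Conj.weight_add] at hwt
  rw [hB, hMF, Conj.holds_add, Conj.holds_add] at hbody
  obtain ⟨⟨hMv, hFv⟩, hGv⟩ := hbody
  have hRl : ∀ A ∈ R, (l A.pred : WithTop ℕ) < headLevel l C.head := by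
    intro A hA
    obtain ⟨A', hA', he⟩ := exists_pred_eq_of_split hsub hMF hMR A hA
    exact he ▸ hF A' hA'
  have hlev : headLevel l C.head = groundLevel l h := by rw [← hv.head, groundLevel_map]
  rw [hlev] at hF hRl
  have hKi := hK.instance hKb hθ
  rw [hMR] at hKi
  obtain ⟨hK1, hK2⟩ := hKi v' (ha _ hcon) (Conj.holds_add.2 ⟨hMv, hR'⟩)
  obtain ⟨hd1, hd2⟩ := hdiff v' (hπ _ hcon) (Conj.holds_add.2 ⟨hFv, hR'⟩)
  refine ⟨v', ?_, hcon, ?_, ?_⟩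
  · rw [← hv.head]
    change C.head.map _ = _
    cases hH : C.head with
    | none => rfl
    | some H =>
      rw [Option.map_some, Option.map_some,
        H.ground_congr fun x hx => (hC x (Or.inl (Or.inl ⟨H, hH, hx⟩))).symm]
  · exact Conj.holds_cons.2 ⟨hK1, Conj.holds_cons.2 ⟨hd1, hGv⟩⟩
  · have h1 := hK2 (groundLevel l h)
    have h2 := hd2 (groundLevel l h)
    -- `F` and `R` weigh nothing at the level of the head, so `K` weighs at most as much as `M`, and
    -- `diff` weighs nothing.
    rw [Conj.weight_add, Conj.weight_eq_zero hP hRl] at h1 h2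
    rw [Conj.weight_eq_zero hP hF] at h2
    simp only [Conj.weight_cons]
    omega

/-! ### The procedure Diff-Define-Fold -/

/-- `E` is a correct replacement for the clause `C`, if `N` are new definitions. -/
structure IsFolding (l : S.Pred → ℕ) (Cls Defs N : Set (Clause S)) (C E : Clause S) : Prop where
  definition : ∀ D ∈ N, IsDefinition l Cls D
  head : E.head = C.head
  level : (∀ A ∈ C.body, (l A.pred : WithTop ℕ) ≤ headLevel l C.head) →
    ∀ A ∈ E.body, (l A.pred : WithTop ℕ) ≤ headLevel l C.head
  -- Quantifying over all larger `Δ` allows firing to be measured in the program with all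
  -- definitions of the run, including later ones.
  fires : ∀ Δ : Set (Clause S), Defs ⊆ Δ → N ⊆ Δ → (∀ D ∈ Δ, IsDefinition l Cls D) →
    Stratified l (definite Cls ∪ Δ) → ∀ h w v, C.Fires (definite Cls ∪ Δ) l h w v →
      ∃ v', E.Fires (definite Cls ∪ Δ) l h w v'

/-- Replacing the block `B` by the head `K` of a definition that has `B` as an instance. -/
theorem isFolding_of_definesIn {Defs N : Set (Clause S)} {C : Clause S} {B G' : Conj S}
    (hB : C.body = B + G') (hN : ∀ D ∈ N, IsDefinition l Cls D) {K : Atom S} {a : Cstr S}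
    (ha : C.con.Entails a) (hl : l K.pred = maxLevel l B)
    (hK : ∀ Δ : Set (Clause S), Defs ⊆ Δ → N ⊆ Δ → (∀ D ∈ Δ, IsDefinition l Cls D) →
      DefinesIn (definite Cls ∪ Δ) l K a B) :
    IsFolding l Cls Defs N C ⟨C.head, C.con, K ::ₘ G'⟩ where
  definition := hN
  head := rfl
  level hC A hA := by
    rw [hB] at hC
    rcases Multiset.mem_cons.1 hA with rfl | hA
    · rw [hl]
      exact maxLevel_le fun A hA => hC A (Multiset.mem_add.2 (Or.inl hA))
    · exact hC A (Multiset.mem_add.2 (Or.inr hA))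
  fires Δ hD hNΔ hΔ _ h w v hv := by
    have hb := hv.body
    have hw := hv.weight
    rw [hB, Conj.holds_add] at hb
    rw [hB, Conj.weight_add] at hw
    obtain ⟨h1, h2⟩ := hK Δ hD hNΔ hΔ v (ha v hv.con) hb.1
    refine ⟨v, hv.head, hv.con, Conj.holds_cons.2 ⟨h1, hb.2⟩, ?_⟩
    simp only [Conj.weight_cons]
    exact le_trans (Nat.add_le_add_right (h2 _) _) hw

/-- Replacing the block `B` by the heads of a definition and of a difference predicate. -/
theorem isFolding_of_diffSplit {Defs N Q : Set (Clause S)} {C : Clause S} {B G' : Conj S}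
    (hB : C.body = B + G') (hN : ∀ D ∈ N, IsDefinition l Cls D)
    {D : Clause S} {M F R : Conj S} {X Y V W : Set (Var S)}
    (hs : DiffSplit l (leastModel (definite Cls ∪ Q)) C B D M F R X Y V W) (hQ : Q ⊆ Defs)
    (hsub : Conj.AtomwiseSubsumes D.body B)
    {π : Cstr S} (hπ : C.con.Entails π) {diff : Atom S} (hdiff : ⟨some diff, π, F + R⟩ ∈ N)
    (hdl : l diff.pred = maxLevel l (F + R))
    {K : Atom S} (hKb : K.HasBasicTypes) {a : Cstr S} (ha : C.con.Entails a)
    (hl : l K.pred = maxLevel l D.body)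
    (hK : ∀ Δ : Set (Clause S), Defs ⊆ Δ → N ⊆ Δ → (∀ D ∈ Δ, IsDefinition l Cls D) →
      DefinesIn (definite Cls ∪ Δ) l K a D.body) :
    IsFolding l Cls Defs N C ⟨C.head, C.con, K ::ₘ diff ::ₘ G'⟩ where
  definition := hN
  head := rfl
  level hC A hA := by
    obtain ⟨-, ⟨hMF, -, -⟩, ⟨⟨θ, hθ, hMR⟩, -⟩, hF⟩ := hs
    have hR : ∀ A ∈ R, (l A.pred : WithTop ℕ) ≤ headLevel l C.head := fun A hA => by
      obtain ⟨A', hA', he⟩ := exists_pred_eq_of_split hsub hMF hMR A hA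
      exact he ▸ (hF A' hA').le
    rw [hB, hMF] at hC
    rcases Multiset.mem_cons.1 hA with rfl | hA
    · rw [hl, ← maxLevel_subst l θ, hMR]
      refine maxLevel_le fun A hA => ?_
      rcases Multiset.mem_add.1 hA with hA | hA
      · exact hC A (by simp [hA])
      · exact hR A hA
    · rcases Multiset.mem_cons.1 hA with rfl | hA
      · rw [hdl]
        refine maxLevel_le fun A hA => ?_
        rcases Multiset.mem_add.1 hA with hA | hA
        · exact (hF A hA).le
        · exact hR A hA
      · exact hC A (by simp [hA])
  fires Δ hD hNΔ hΔ hP h w v hv :=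
    hs.exists_valuation (Set.union_subset_union_right _ (hQ.trans hD)) hP hB hsub hπ
      (definesIn_of_mem hΔ (hNΔ hdiff) rfl) hKb (hK Δ hD hNΔ hΔ) ha hv

/-- For soundness the rules differ only in which definition heads replace the block: one head for
fold, generalize and project, and an additional difference atom in the other two cases. -/
theorem DDFStep.cases_folding {m : Mode S} {Defs : Set (Clause S)} {s s' : DDFState S}
    (h : DDFStep m l Cls Defs s s')
    (hD : ∀ D ∈ Defs ∪ s.newDefs, IsDefinition l Cls D) :
    (∃ C ∈ s.inCls, C.HasBasicTypes ∧ s' = ⟨s.inCls \ {C}, s.newDefs, insert C s.fldCls⟩) ∨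
    ∃ C ∈ s.inCls, ∃ E N, IsFolding l Cls (Defs ∪ s.newDefs) N C E ∧
      s' = ⟨insert E (s.inCls \ {C}), N ∪ s.newDefs, s.fldCls⟩ := by
  have hvar : ∀ {Δ' : Set (Clause S)} {D K}, (Δ' ⊆ Defs ∪ s.newDefs) → IsDefVariant Δ' D K →
      K.HasBasicTypes ∧ l K.pred = maxLevel l D.body ∧ ∀ A ∈ D.body, ¬ A.HasBasicTypes := by
    rintro Δ' D K hΔ' ⟨⟨D₀, hD₀, hv⟩, hK, -⟩
    obtain ⟨⟨K', hK', hb, -, hl⟩, hB⟩ := (hD D₀ (hΔ' hD₀)).variant hv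
    rw [hK] at hK'
    cases hK'
    exact ⟨hb, hl, hB⟩
  have hold : ∀ {N : Set (Clause S)}, Cls ⊆ Cls ∪ Defs ∪ N := fun {N} =>
    Set.subset_union_left.trans Set.subset_union_left
  -- The body of a difference definition comes from the selected block and from an instance of a
  -- definition's body, and both consist of atoms with ADT arguments.
  have hdb : ∀ {B D' M F R : Conj S} {θ : Subst S}, (∀ A ∈ B, ¬ A.HasBasicTypes) →
      (∀ A ∈ D', ¬ A.HasBasicTypes) → B = M + F → Conj.subst θ D' = M + R →
      ∀ A ∈ F + R, ¬ A.HasBasicTypes := by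
    intro B D' M F R θ hB hD' hMF hMR A hA
    rcases Multiset.mem_add.1 hA with hA | hA
    · exact hB A (by simp [hMF, hA])
    · have hAθ : A ∈ Conj.subst θ D' := by simp [hMR, hA]
      obtain ⟨A', hA', rfl⟩ := Multiset.mem_map.1 hAθ
      exact hD' A' hA'
  cases h with
  | basic I N L C hC hb => exact Or.inl ⟨C, hC, hb, rfl⟩
  | fold I N L C hC hb B G' hB D K hDm hcd =>
    refine Or.inr ⟨C, hC, _, ∅, ?_, by rw [Set.empty_union]⟩
    obtain ⟨hDv, θ, hθ, hBθ⟩ := hDm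
    obtain ⟨hKb, hKl, -⟩ := hvar subset_rfl hDv
    refine isFolding_of_definesIn hB.1 (by simp) hcd ?_ fun Δ h1 _ hΔ => ?_
    · rw [hKl, hBθ, maxLevel_subst]
    · rw [hBθ]
      exact (definesIn_of_isDefVariant hΔ h1 hDv).instance hKb hθ
  | generalize I N L C hC hb B G' hB hnofold D K hDm a ha genp hgen =>
    refine Or.inr ⟨C, hC, _, {⟨some genp, a, D.body⟩}, ?_, by rw [Set.singleton_union]⟩
    obtain ⟨hDv, θ, hθ, hBθ⟩ := hDm
    obtain ⟨-, -, hDb⟩ := hvar subset_rfl hDv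
    refine isFolding_of_definesIn hB.1 ?_ ha.2 ?_ fun Δ _ h2 hΔ => ?_
    · rintro _ rfl
      exact hgen.isDefinition hold hDb a
    · rw [hgen.2.2, hBθ, maxLevel_subst]
    · rw [hBθ]
      exact (definesIn_of_mem hΔ (h2 rfl) rfl).instance hgen.1.1 hθ
  | diffFold I N L C hC hb B G' hB _ D K hDv hsub M F R X Y V W hs π hπ diff hdiff hcd =>
    refine Or.inr ⟨C, hC, _, {⟨some diff, π, F + R⟩}, ?_, by rw [Set.singleton_union]⟩
    obtain ⟨hKb, hKl, hDb⟩ := hvar subset_rfl hDv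
    have hs := hs.1
    rw [Set.union_assoc] at hs
    refine isFolding_of_diffSplit hB.1 ?_ hs subset_rfl hsub hπ.2 (Set.mem_singleton _)
      hdiff.2.2 hKb hcd hKl
      fun Δ h1 _ hΔ => definesIn_of_isDefVariant hΔ h1 hDv
    rintro _ rfl
    obtain ⟨-, ⟨hMF, -, -⟩, ⟨⟨θ, -, hMR⟩, -⟩, -⟩ := hs
    exact hdiff.isDefinition hold (hdb hB.not_hasBasicTypes hDb hMF hMR) π
  | diffGeneralize I N L C hC hb B G' hB _ D K hDv hsub M F R X Y V W hs π hπ diff hdiff hcd a ha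
      genp hgen =>
    refine Or.inr ⟨C, hC, _, {⟨some genp, a, D.body⟩, ⟨some diff, π, F + R⟩}, ?_,
      by rw [Set.insert_union, Set.singleton_union]⟩
    obtain ⟨-, -, hDb⟩ := hvar subset_rfl hDv
    have hs := hs.1
    rw [Set.union_assoc] at hs
    refine isFolding_of_diffSplit hB.1 ?_ hs subset_rfl hsub hπ.2 (Or.inr rfl) hdiff.2.2
      hgen.1.1 ha.2 hgen.2.2 fun Δ _ h2 hΔ => definesIn_of_mem hΔ (h2 (Or.inl rfl)) rfl
    rintro _ (rfl | rfl)
    · exact hgen.isDefinition hold hDb a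
    · obtain ⟨-, ⟨hMF, -, -⟩, ⟨⟨θ, -, hMR⟩, -⟩, -⟩ := hs
      exact hdiff.isDefinition hold (hdb hB.not_hasBasicTypes hDb hMF hMR) π
  | project I N L C hC hb B G' hB _ _ π hπ newp hnew =>
    refine Or.inr ⟨C, hC, _, {⟨some newp, π, B⟩}, ?_, by rw [Set.singleton_union]⟩
    refine isFolding_of_definesIn hB.1 ?_ hπ.2 hnew.2.2 fun Δ _ h2 hΔ =>
      definesIn_of_mem hΔ (h2 rfl) rfl
    rintro _ rfl
    exact hnew.isDefinition hold hB.not_hasBasicTypes π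

/-- The property of the states of the procedure that every step preserves. -/
structure DDFInvariant (l : S.Pred → ℕ) (Cls Defs : Set (Clause S)) (s : DDFState S) : Prop where
  definition : ∀ D ∈ Defs ∪ s.newDefs, IsDefinition l Cls D
  stratified : Stratified l (s.inCls ∪ s.fldCls)
  basic : ∀ C ∈ s.fldCls, C.HasBasicTypes

theorem DDFStep.newDefs_subset {m : Mode S} {Defs : Set (Clause S)} {s s' : DDFState S}
    (h : DDFStep m l Cls Defs s s') : s.newDefs ⊆ s'.newDefs := by
  cases h
  all_goals
    intro D hD
    simp only [Set.mem_insert_iff]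
    first | exact hD | exact Or.inr hD | exact Or.inr (Or.inr hD)

theorem DDFStep.invariant {m : Mode S} {Defs : Set (Clause S)} {s s' : DDFState S}
    (h : DDFStep m l Cls Defs s s') (hs : DDFInvariant l Cls Defs s) :
    DDFInvariant l Cls Defs s' := by
  rcases h.cases_folding hs.definition with ⟨C, hC, hb, rfl⟩ | ⟨C, hC, E, N, hE, rfl⟩
  · refine ⟨hs.definition, fun C' hC' => ?_, ?_⟩
    · rcases hC' with hC' | rfl | hC'
      · exact hs.stratified C' (Or.inl hC'.1)
      · exact hs.stratified _ (Or.inl hC)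
      · exact hs.stratified C' (Or.inr hC')
    · rintro C' (rfl | hC')
      · exact hb
      · exact hs.basic C' hC'
  · refine ⟨?_, ?_, hs.basic⟩
    · rintro D (hD | hD | hD)
      · exact hs.definition D (Or.inl hD)
      · exact hE.definition D hD
      · exact hs.definition D (Or.inr hD)
    · rintro C' ((rfl | hC') | hC')
      · rw [hE.head]
        exact hE.level (hs.stratified C (Or.inl hC))
      · exact hs.stratified C' (Or.inl hC'.1)
      · exact hs.stratified C' (Or.inr hC')

theorem DDFStep.covers {m : Mode S} {Defs Δ : Set (Clause S)} {s s' : DDFState S}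
    (h : DDFStep m l Cls Defs s s') (hs : DDFInvariant l Cls Defs s)
    (hDΔ : Defs ∪ s'.newDefs ⊆ Δ) (hΔ : ∀ D ∈ Δ, IsDefinition l Cls D)
    (hP : Stratified l (definite Cls ∪ Δ)) {g : Option (GAtom S)} {w : ℕ}
    (hc : Covers (definite Cls ∪ Δ) l (s.inCls ∪ s.fldCls) g w) :
    Covers (definite Cls ∪ Δ) l (s'.inCls ∪ s'.fldCls) g w := by
  obtain ⟨C', hC', v, hv⟩ := hc
  rcases h.cases_folding hs.definition with ⟨C, hC, hb, rfl⟩ | ⟨C, hC, E, N, hE, rfl⟩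
  · refine ⟨C', ?_, v, hv⟩
    by_cases he : C' = C
    · exact Or.inr (Or.inl he)
    · exact hC'.imp (fun h => ⟨h, he⟩) Or.inr
  · by_cases he : C' = C
    · subst he
      have hDs : Defs ∪ s.newDefs ⊆ Δ :=
        (Set.union_subset_union_right _ h.newDefs_subset).trans hDΔ
      have hN : N ⊆ Δ := fun D hD => hDΔ (Or.inr (Or.inl hD))
      obtain ⟨v', hv'⟩ := hE.fires Δ hDs hN hΔ hP g w v hv
      exact ⟨E, Or.inl (Or.inl rfl), v', hv'⟩
    · exact ⟨C', hC'.imp (fun h => Or.inr ⟨h, he⟩) id, v, hv⟩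

theorem DDFInvariant.reflTransGen {m : Mode S} {Defs : Set (Clause S)} {s s' : DDFState S}
    (h : Relation.ReflTransGen (DDFStep m l Cls Defs) s s') (hs : DDFInvariant l Cls Defs s) :
    DDFInvariant l Cls Defs s' := by
  induction h with
  | refl => exact hs
  | tail _ h ih => exact h.invariant ih

theorem covers_of_reflTransGen_ddfStep {m : Mode S} {Defs Δ : Set (Clause S)} {s s' : DDFState S}
    (h : Relation.ReflTransGen (DDFStep m l Cls Defs) s s') (hs : DDFInvariant l Cls Defs s)
    (hDΔ : Defs ∪ s'.newDefs ⊆ Δ) (hΔ : ∀ D ∈ Δ, IsDefinition l Cls D)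
    (hP : Stratified l (definite Cls ∪ Δ)) {g : Option (GAtom S)} {w : ℕ}
    (hc : Covers (definite Cls ∪ Δ) l (s.inCls ∪ s.fldCls) g w) :
    Covers (definite Cls ∪ Δ) l (s'.inCls ∪ s'.fldCls) g w := by
  induction h with
  | refl => exact hc
  | tail h h' ih =>
    exact h'.covers (hs.reflTransGen h) hDΔ hΔ hP
      (ih ((Set.union_subset_union_right _ h'.newDefs_subset).trans hDΔ))

end

/-! ### Firing under substitutions, and clauses free of defined predicates -/

theorem Clause.Fires.mono {P : Set (Clause S)} {l : S.Pred → ℕ} {h : Option (GAtom S)}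
    {w w' : ℕ} {C : Clause S} {v : Valuation S} (hv : C.Fires P l h w v) (hw : w ≤ w') :
    C.Fires P l h w' v :=
  ⟨hv.head, hv.con, hv.body, hv.weight.trans hw⟩

theorem Clause.fires_subst {P : Set (Clause S)} {l : S.Pred → ℕ} {h : Option (GAtom S)}
    {w : ℕ} {C : Clause S} {θ : Subst S} {v : Valuation S} (hv : C.Fires P l h w (θ.evalAt v)) :
    (C.subst θ).Fires P l h w v where
  head := by
    rw [← hv.head, Clause.subst, Option.map_map]
    exact congrArg (fun f => Option.map f C.head) (funext fun A => A.ground_subst θ v)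
  con := (Cstr.holds_subst _ _ _).2 hv.con
  body := (Conj.holds_subst _ _ _ _).2 hv.body
  weight := (Conj.weight_subst _ _ _).trans_le hv.weight

theorem headLevel_map_subst (l : S.Pred → ℕ) (σ : Subst S) (H : Option (Atom S)) :
    headLevel l (H.map (Atom.subst σ)) = headLevel l H := by
  cases H <;> rfl

theorem Cstr.eqAll_holds {v : Valuation S} {ρ : Ty S.Adt → ℕ → ℕ} (Y : List (Var S))
    (h : ∀ y ∈ Y, v y.1 y.2 = v y.1 (ρ y.1 y.2)) : (Cstr.eqAll ρ Y).Holds v := by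
  induction Y with
  | nil => trivial
  | cons y Y ih =>
    refine ⟨?_, ih fun z hz => h z (List.mem_cons_of_mem _ hz)⟩
    have hy := h y List.mem_cons_self
    obtain ⟨τ, x⟩ := y
    cases τ with
    | int => exact congrArg Val.toInt hy
    | bool =>
      exact iff_of_eq (congrArg (fun a => Val.toBool a = true) hy)
    | adt a => trivial

section

variable {l : S.Pred → ℕ} {Cls Δ : Set (Clause S)}

/-- The clause is stratified and its body has no predicate defined in `Δ`. -/
def IsUnfolded (l : S.Pred → ℕ) (Δ : Set (Clause S)) (C : Clause S) : Prop :=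
  ∀ A ∈ C.body, NotDefinedIn Δ A.pred ∧ (l A.pred : WithTop ℕ) ≤ headLevel l C.head

theorem IsUnfolded.of_pred {C C' : Clause S} (h : IsUnfolded l Δ C)
    (hh : headLevel l C'.head = headLevel l C.head)
    (hb : ∀ A ∈ C'.body, ∃ A' ∈ C.body, A'.pred = A.pred) : IsUnfolded l Δ C' := by
  intro A hA
  obtain ⟨A', hA', he⟩ := hb A hA
  rw [hh, ← he]
  exact h A' hA'

/-- Defined predicates have basic types, while the body atoms of a definition do not; so the
property holds even before unfolding. -/
theorem IsDefinition.isUnfolded (hΔ : ∀ D ∈ Δ, IsDefinition l Cls D) {D : Clause S}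
    (hD : IsDefinition l Cls D) : IsUnfolded l Δ D := by
  obtain ⟨⟨K, hK, -, -, hl⟩, hB⟩ := hD
  intro A hA
  refine ⟨notDefinedIn_of_not_hasBasicTypes hΔ (hB A hA), ?_⟩
  rw [hK]
  exact WithTop.coe_le_coe.2 (hl ▸ le_maxLevel hA)

/-! ### The procedure Unfold -/

theorem MClause.Delegates.headLevel_eq {P Q : MClause S} (h : P.Delegates Q) :
    headLevel l Q.head = headLevel l P.head := by
  obtain ⟨N, ρ, -, -, hh, -⟩ := h
  rw [← hh, headLevel_map_subst]

theorem MClause.Delegates.exists_pred {P Q : MClause S} (h : P.Delegates Q) {A : Atom S}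
    (hA : A ∈ Q.marked + Q.rest) : ∃ A' ∈ P.marked + P.rest, A'.pred = A.pred := by
  obtain ⟨N, ρ, -, -, -, -, hm, hr⟩ := h
  rw [← hm, ← hr]
  refine ⟨A.subst (Subst.ofNames ρ), ?_, rfl⟩
  rcases Multiset.mem_add.1 hA with hA | hA
  · exact Multiset.mem_add.2 (Or.inl (Multiset.mem_map_of_mem _ hA))
  · exact Multiset.mem_add.2 (Or.inr (Multiset.mem_map_of_mem _ hA))

theorem MClause.Delegates.exists_marked {P Q : MClause S} (h : P.Delegates Q) {A : Atom S}
    (hA : A ∈ P.marked) : ∃ A' ∈ Q.marked, A'.pred = A.pred := by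
  obtain ⟨N, ρ, -, -, -, -, hm, -⟩ := h
  rw [← hm] at hA
  obtain ⟨A', hA', rfl⟩ := Multiset.mem_map.1 hA
  exact ⟨A', hA', rfl⟩

theorem MClause.Delegates.fires {P Q : MClause S} (h : P.Delegates Q) {Pr : Set (Clause S)}
    {g : Option (GAtom S)} {w : ℕ} {v : Valuation S} (hv : P.toClause.Fires Pr l g w v) :
    ∃ v', Q.toClause.Fires Pr l g w v' := by
  obtain ⟨N, ρ, hN, hρ, hh, hc, hm, hr⟩ := h
  have hbody : Conj.subst (Subst.ofNames ρ) (Q.marked + Q.rest) = P.marked + P.rest := by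
    rw [← hm, ← hr]
    exact Multiset.map_add _ _ _
  -- Each new variable takes the value of the variable it stands for. As `ρ` sends `N` outside `N`,
  -- where it is the identity, the added equations hold.
  refine ⟨(Subst.ofNames ρ).evalAt v, ?_, ?_, ?_, ?_⟩
  · rw [← hv.head]
    change Option.map _ Q.head = Option.map _ P.head
    rw [← hh, Option.map_map]
    exact congrArg (fun f => Option.map f Q.head)
      (funext fun A => (A.ground_subst (Subst.ofNames ρ) v).symm)
  · change Cstr.Holds _ Q.con
    rw [hc]
    refine ⟨(P.con.holds_congr fun x hx => ?_).1 hv.con, Cstr.eqAll_holds N fun y hy => ?_⟩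
    · have hxN : x ∉ N := fun hxN => (hN x hxN).2.1 (Or.inl (Or.inr hx))
      change v x.1 x.2 = v x.1 (ρ x.1 x.2)
      rw [hρ x.1 x.2 hxN]
    · change v y.1 (ρ y.1 y.2) = v y.1 (ρ y.1 (ρ y.1 y.2))
      rw [hρ _ _ (hN y hy).2.2]
  · rw [← Conj.holds_subst]
    change Conj.Holds _ _ (Conj.subst _ (Q.marked + Q.rest))
    rw [hbody]
    exact hv.body
  · rw [← Conj.weight_subst]
    change Conj.weight _ _ _ _ (Conj.subst _ (Q.marked + Q.rest)) ≤ w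
    rw [hbody]
    exact hv.weight

/-- Unfolding preserves the instances that fire; the unfolded atom reduces the weight. -/
theorem IsUnfolding.exists_fires (hΔ : ∀ D ∈ Δ, IsDefinition l Cls D) {P : MClause S}
    {A : Atom S} {T L : Conj S} {Q : Set (MClause S)}
    (hQ : IsUnfolding (definite Cls) P A T L Q) (hb : P.marked + P.rest = A ::ₘ (T + L))
    (hA : NotDefinedIn Δ A.pred) {h : Option (GAtom S)} {w : ℕ} {v : Valuation S}
    (hv : P.toClause.Fires (definite Cls ∪ Δ) l h w v) :
    ∃ q ∈ Q, ∃ v' w', w' + nodeWeight l (groundLevel l h) A.pred ≤ w ∧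
      q.toClause.Fires (definite Cls ∪ Δ) l h w' v' ∧
        ∀ B ∈ T, ∃ B' ∈ q.marked, B'.pred = B.pred := by
  classical
  have hbody := hv.body
  have hwt := hv.weight
  change Conj.Holds _ _ (P.marked + P.rest) at hbody
  change Conj.weight _ _ _ _ (P.marked + P.rest) ≤ _ at hwt
  rw [hb, Conj.holds_cons] at hbody
  rw [hb, Conj.weight_cons] at hwt
  obtain ⟨D, hD, H, hH, u, hg, hcon, hDb, hDw⟩ :=
    leastModel_inversion (g := A.ground v) (head_ne_none_of_mem hΔ) l (groundLevel l h) hbody.1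
  have hpred : H.pred = A.pred := congrArg Sigma.fst hg
  -- The last clause of a minimal proof of the atom is not a definition, so it is among the clauses
  -- used for unfolding.
  have hD' : D ∈ definite Cls := hD.resolve_right fun hD => hA D hD H hH hpred
  obtain ⟨D', K, ⟨hvar, hdisj, hK⟩, hunif⟩ := hQ.2 D hD'
  obtain ⟨σ, τ, rfl, -, hστ⟩ := Clause.IsVariant.exists_inverse hvar
  obtain rfl : H.subst σ = K := by
    simpa [Clause.subst, hH] using hK
  -- Glue `v` on the variables of `P` to the valuation from the proof, transported to the variant;
  -- renaming apart makes the two compatible.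
  let x₀ : Valuation S := fun τ' x =>
    if (τ', x) ∈ P.toClause.vars then v τ' x else τ.evalAt u τ' x
  have hx₁ : ∀ x ∈ P.toClause.vars, v x.1 x.2 = x₀ x.1 x.2 := fun x hx => (if_pos hx).symm
  have hx₂ : ∀ x ∈ (D.subst σ).vars, τ.evalAt u x.1 x.2 = x₀ x.1 x.2 := fun x hx =>
    (if_neg fun hx' => Set.disjoint_left.1 hdisj hx hx').symm
  have hbv : ∀ B ∈ A ::ₘ (T + L), ∀ x ∈ B.vars, v x.1 x.2 = x₀ x.1 x.2 := fun B hB x hx =>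
    hx₁ x (Or.inr ⟨B, show B ∈ P.marked + P.rest from hb ▸ hB, hx⟩)
  have hAK : A.ground x₀ = (H.subst σ).ground x₀ := by
    rw [← A.ground_congr (hbv A (Multiset.mem_cons_self _ _)),
      ← (H.subst σ).ground_congr fun x hx => hx₂ x (Or.inl (Or.inl ⟨_, hK, hx⟩)),
      Atom.ground_subst, hστ, hg]
  obtain ⟨θ, hθ, hq⟩ := hunif ⟨_, Atom.subst_toSubst_eq hAK⟩
  obtain ⟨v', hv'⟩ := hθ.exists_evalAt_eq x₀ (Atom.subst_toSubst_eq hAK)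
  have hc : ((Cstr.and P.con (D.subst σ).con).subst θ).Holds v' := by
    rw [Cstr.holds_subst, hv']
    refine ⟨(Cstr.holds_congr _ fun x hx => hx₁ x (Or.inl (Or.inr hx))).1 hv.con,
      (Cstr.holds_congr _ fun x hx => hx₂ x (Or.inl (Or.inr hx))).1 ?_⟩
    change Cstr.Holds _ (D.con.subst σ)
    rw [Cstr.holds_subst, hστ]
    exact hcon
  obtain ⟨q, hqQ, hqd⟩ := hq ⟨v', hc⟩
  have hTL : ∀ x ∈ Conj.vars (T + L), v x.1 x.2 = x₀ x.1 x.2 := fun x ⟨B, hB, hx⟩ =>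
    hbv B (Multiset.mem_cons_of_mem hB) x hx
  have hDv : ∀ x ∈ Conj.vars (D.subst σ).body, τ.evalAt u x.1 x.2 = x₀ x.1 x.2 := fun x hx =>
    hx₂ x (Or.inr hx)
  have hub : (unfoldedClause P T L (D.subst σ) θ).toClause.body =
      Conj.subst θ (T + L + (D.subst σ).body) := by
    change Conj.subst θ T + Conj.subst θ (L + (D.subst σ).body) = _
    simp only [Conj.subst, Multiset.map_add, add_assoc]
  -- The subtraction does not truncate: by inversion the weight of the unfolded atom already
  -- includes its node weight.
  have hfire : (unfoldedClause P T L (D.subst σ) θ).toClause.Fires (definite Cls ∪ Δ) l h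
      (w - nodeWeight l (groundLevel l h) A.pred) v' := by
    refine ⟨?_, hc, ?_, ?_⟩
    · rw [← hv.head]
      change Option.map _ (Option.map _ P.head) = Option.map _ P.head
      cases hPH : P.head with
      | none => rfl
      | some B =>
        simp only [Option.map_some, Atom.ground_subst, hv']
        rw [B.ground_congr fun x hx => hx₁ x (Or.inl (Or.inl ⟨B, hPH, hx⟩))]
    · rw [hub, Conj.holds_subst, hv', Conj.holds_add, ← Conj.holds_congr _ _ hTL,
        ← Conj.holds_congr _ _ hDv]
      refine ⟨hbody.2, ?_⟩
      change Conj.Holds _ _ (Conj.subst σ D.body)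
      rw [Conj.holds_subst, hστ]
      exact hDb
    · rw [hub, Conj.weight_subst, hv', Conj.weight_add, ← Conj.weight_congr _ hTL,
        ← Conj.weight_congr _ hDv]
      change _ + Conj.weight _ _ _ _ (Conj.subst σ D.body) ≤ _
      rw [Conj.weight_subst, hστ]
      change Conj.weight _ _ _ u D.body + nodeWeight _ _ A.pred ≤ _ at hDw
      omega
  obtain ⟨v'', hv''⟩ := hqd.fires hfire
  refine ⟨q, hqQ, v'', _, ?_, hv'', fun B hB => ?_⟩
  · change Conj.weight _ _ _ u D.body + nodeWeight _ _ A.pred ≤ _ at hDw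
    omega
  · exact hqd.exists_marked (A := B.subst θ) (Multiset.mem_map_of_mem _ hB)

/-- Atoms brought in come from clauses of `Cls`, hence carry no defined predicate, and their level
is at most that of the unfolded atom. -/
theorem IsUnfolding.isUnfolded (hΔ : ∀ D ∈ Δ, IsDefinition l Cls D) (hs : Stratified l Cls)
    {P : MClause S} {A : Atom S} {T L : Conj S} {Q : Set (MClause S)}
    (hQ : IsUnfolding (definite Cls) P A T L Q) (hb : P.marked + P.rest = A ::ₘ (T + L))
    (hP : IsUnfolded l Δ P.toClause) : ∀ q ∈ Q, IsUnfolded l Δ q.toClause := by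
  intro q hq B hB
  obtain ⟨D, hD, D', K, θ, ⟨⟨ρ, rfl⟩, -, hK⟩, hθ, -, hd⟩ := hQ.1 q hq
  have hP' : ∀ B ∈ A ::ₘ (T + L),
      NotDefinedIn Δ B.pred ∧ (l B.pred : WithTop ℕ) ≤ headLevel l P.head := fun B hB =>
    hP B (show B ∈ P.marked + P.rest from hb ▸ hB)
  have hlev : headLevel l q.toClause.head = headLevel l P.head :=
    hd.headLevel_eq.trans (headLevel_map_subst l θ P.head)
  have hAK : A.subst θ = K.subst θ := hθ.1
  have hpred : (A.subst θ).pred = (K.subst θ).pred := congrArg Atom.pred hAK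
  change A.pred = K.pred at hpred
  obtain ⟨B', hB', he⟩ := hd.exists_pred hB
  rw [← he, hlev]
  have hB'' : B' ∈ Conj.subst θ (T + L + Conj.subst (Subst.ofNames fun τ x => ρ τ x) D.body) := by
    change B' ∈ Conj.subst θ T + Conj.subst θ
      (L + Conj.subst (Subst.ofNames fun τ x => ρ τ x) D.body) at hB'
    simpa only [Conj.subst, Multiset.map_add, add_assoc] using hB'
  obtain ⟨B₁, hB₁, rfl⟩ := Multiset.mem_map.1 hB''
  rcases Multiset.mem_add.1 hB₁ with hB₁ | hB₁
  · exact hP' B₁ (Multiset.mem_cons_of_mem hB₁)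
  · obtain ⟨B₂, hB₂, rfl⟩ := Multiset.mem_map.1 hB₁
    refine ⟨notDefinedIn_of_mentions hΔ hD.1 (Or.inr ⟨B₂, hB₂, rfl⟩), ?_⟩
    refine le_trans ?_ (hP' A (Multiset.mem_cons_self _ _)).2
    rw [hpred]
    have h := hs D hD.1 B₂ hB₂
    rw [← headLevel_map_subst l (Subst.ofNames fun τ x => ρ τ x)] at h
    change _ ≤ headLevel l (Clause.subst _ D).head at h
    rw [hK] at h
    exact h

/-- Some instance of a clause of `U` fires with smaller weight, or with the same weight and with a
marked atom that contributes to the weight when it is unfolded. -/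
def CoversMarked (Pr : Set (Clause S)) (l : S.Pred → ℕ) (U : Set (MClause S))
    (h : Option (GAtom S)) (w : ℕ) : Prop :=
  ∃ P ∈ U, ∃ v w', P.toClause.Fires Pr l h w' v ∧
    (w' < w ∨ w' ≤ w ∧ ∃ B ∈ P.marked, nodeWeight l (groundLevel l h) B.pred = 1)

theorem Phase1Step.isUnfolded (hΔ : ∀ D ∈ Δ, IsDefinition l Cls D) (hs : Stratified l Cls)
    {U U' : Set (MClause S)} (h : Phase1Step (definite Cls) U U')
    (hU : ∀ P ∈ U, IsUnfolded l Δ P.toClause) : ∀ P ∈ U', IsUnfolded l Δ P.toClause := by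
  obtain ⟨P, hP, A, T, hA, Q, hQ⟩ := h
  rintro q (hq | hq)
  · exact hU q hq.1
  · exact hQ.isUnfolded hΔ hs (by rw [hA, Multiset.cons_add]) (hU P hP) q hq

/-- If the contributing marked atom is the one unfolded, the weight drops; otherwise it is inherited
with its mark, and the drop is still to come. -/
theorem Phase1Step.covers (hΔ : ∀ D ∈ Δ, IsDefinition l Cls D)
    {U U' : Set (MClause S)} (h : Phase1Step (definite Cls) U U')
    (hU : ∀ P ∈ U, IsUnfolded l Δ P.toClause) {g : Option (GAtom S)} {w : ℕ}
    (hc : CoversMarked (definite Cls ∪ Δ) l U g w) :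
    CoversMarked (definite Cls ∪ Δ) l U' g w := by
  obtain ⟨P, hP, A, T, hA, Q, hQ⟩ := h
  obtain ⟨P', hP', v, w', hv, hw⟩ := hc
  by_cases he : P' = P
  · subst he
    have hb : P'.marked + P'.rest = A ::ₘ (T + P'.rest) := by rw [hA, Multiset.cons_add]
    obtain ⟨q, hq, v'', w'', hw'', hv'', hT⟩ := hQ.exists_fires hΔ hb
      (hU P' hP A (show A ∈ P'.marked + P'.rest by simp [hA])).1 hv
    refine ⟨q, Or.inr hq, v'', w'', hv'', ?_⟩
    rcases hw with hw | ⟨hw, B, hB, hB1⟩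
    · exact Or.inl (by omega)
    · rw [hA] at hB
      rcases Multiset.mem_cons.1 hB with rfl | hB
      · exact Or.inl (by omega)
      · obtain ⟨B', hB', hp⟩ := hT B hB
        exact Or.inr ⟨by omega, B', hB', by rw [hp, hB1]⟩
  · exact ⟨P', Or.inl ⟨hP', he⟩, v, w', hv, hw⟩

theorem Phase2Step.exists_isUnfolding {m : Mode S}
    {prec : List ((τ : Ty S.Adt) × Term S τ) → List ((τ : Ty S.Adt) × Term S τ) → Prop}
    {Ds : Set (Clause S)} {U U' : Set (MClause S)} (h : Phase2Step m prec Ds U U') :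
    ∃ P ∈ U, ∃ A T L Q, P.marked + P.rest = A ::ₘ (T + L) ∧ IsUnfolding Ds P A T L Q ∧
      U' = (U \ {P}) ∪ Q := by
  cases h with
  | unfoldable P hP A T hA _ Q hQ =>
    exact ⟨P, hP, A, T, P.rest, Q, by rw [hA, Multiset.cons_add], hQ, rfl⟩
  | descending P hP A L hA _ _ Q hQ =>
    exact ⟨P, hP, A, P.marked, L, Q, by rw [hA, Multiset.add_cons], hQ, rfl⟩

theorem Phase2Step.isUnfolded {m : Mode S}
    {prec : List ((τ : Ty S.Adt) × Term S τ) → List ((τ : Ty S.Adt) × Term S τ) → Prop}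
    (hΔ : ∀ D ∈ Δ, IsDefinition l Cls D) (hs : Stratified l Cls)
    {U U' : Set (MClause S)} (h : Phase2Step m prec (definite Cls) U U')
    (hU : ∀ P ∈ U, IsUnfolded l Δ P.toClause) : ∀ P ∈ U', IsUnfolded l Δ P.toClause := by
  obtain ⟨P, hP, A, T, L, Q, hb, hQ, rfl⟩ := h.exists_isUnfolding
  rintro q (hq | hq)
  · exact hU q hq.1
  · exact hQ.isUnfolded hΔ hs hb (hU P hP) q hq

theorem Phase2Step.covers {m : Mode S}
    {prec : List ((τ : Ty S.Adt) × Term S τ) → List ((τ : Ty S.Adt) × Term S τ) → Prop}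
    (hΔ : ∀ D ∈ Δ, IsDefinition l Cls D)
    {U U' : Set (MClause S)} (h : Phase2Step m prec (definite Cls) U U')
    (hU : ∀ P ∈ U, IsUnfolded l Δ P.toClause) {g : Option (GAtom S)} {w : ℕ}
    (hc : Covers (definite Cls ∪ Δ) l (MClause.toClause '' U) g w) :
    Covers (definite Cls ∪ Δ) l (MClause.toClause '' U') g w := by
  obtain ⟨P, hP, A, T, L, Q, hb, hQ, rfl⟩ := h.exists_isUnfolding
  obtain ⟨_, ⟨P', hP', rfl⟩, v, hv⟩ := hc
  by_cases he : P' = P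
  · subst he
    obtain ⟨q, hq, v'', w'', hw'', hv'', -⟩ := hQ.exists_fires hΔ hb
      (hU P' hP A (show A ∈ P'.marked + P'.rest by simp [hb])).1 hv
    exact ⟨_, ⟨q, Or.inr hq, rfl⟩, v'', hv''.mono (by omega)⟩
  · exact ⟨_, ⟨P', Or.inl ⟨hP', he⟩, rfl⟩, v, hv⟩

theorem nodeWeight_eq_one {A : Atom S} {n : WithTop ℕ} (hn : (l A.pred : WithTop ℕ) = n)
    (hA : ¬ A.HasBasicTypes) : nodeWeight l n A.pred = 1 :=
  if_pos ⟨hn, not_forall.1 hA⟩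

/-- The strict inequality is the source of termination for the final induction: Phase 1 cannot end
before the marked atom at the level of the head has been unfolded, and Phase 2 never increases
weight. -/
theorem Unfold.isUnfolded_and_covers {m : Mode S}
    {prec : List ((τ : Ty S.Adt) × Term S τ) → List ((τ : Ty S.Adt) × Term S τ) → Prop}
    {NewDefs UnfCls : Set (Clause S)} (hu : Unfold m l prec NewDefs (definite Cls) UnfCls)
    (hΔ : ∀ D ∈ Δ, IsDefinition l Cls D) (hs : Stratified l Cls) (hN : NewDefs ⊆ Δ) :
    (∀ C ∈ UnfCls, IsUnfolded l Δ C) ∧ ∀ D ∈ NewDefs, ∀ h w v,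
      D.Fires (definite Cls ∪ Δ) l h w v → ∃ w' < w, Covers (definite Cls ∪ Δ) l UnfCls h w' := by
  obtain ⟨mark, U₁, U₂, hmark, h1, hm1, h2, -, rfl⟩ := hu
  have hU₀ : ∀ P ∈ mark '' NewDefs, IsUnfolded l Δ P.toClause := by
    rintro _ ⟨D, hD, rfl⟩
    rw [(hmark D hD).1]
    exact (hΔ D (hN hD)).isUnfolded hΔ
  have hU₁ : ∀ U, Relation.ReflTransGen (Phase1Step (definite Cls)) (mark '' NewDefs) U →
      ∀ P ∈ U, IsUnfolded l Δ P.toClause := by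
    intro U hU
    induction hU with
    | refl => exact hU₀
    | tail _ h ih => exact h.isUnfolded hΔ hs ih
  have hremark : ∀ P : MClause S,
      MClause.toClause ⟨P.head, P.con, P.marked + P.rest, 0⟩ = P.toClause := fun P => by
    simp only [MClause.toClause, add_zero]
  have hU₂ : ∀ U, Relation.ReflTransGen (Phase2Step m prec (definite Cls))
      ((fun P : MClause S => ⟨P.head, P.con, P.marked + P.rest, 0⟩) '' U₁) U →
      ∀ P ∈ U, IsUnfolded l Δ P.toClause := by
    intro U hU
    induction hU with
    | refl =>
      rintro _ ⟨P, hP, rfl⟩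
      rw [hremark]
      exact hU₁ U₁ h1 P hP
    | tail _ h ih => exact h.isUnfolded hΔ hs ih
  refine ⟨?_, fun D hD h w v hv => ?_⟩
  · rintro _ ⟨P, hP, rfl⟩
    exact hU₂ U₂ h2 P hP
  · have hc₀ : CoversMarked (definite Cls ∪ Δ) l (mark '' NewDefs) h w := by
      obtain ⟨hD', ⟨H, A, T, hH, hA, hl, -⟩, -⟩ := hmark D hD
      refine ⟨_, ⟨D, hD, rfl⟩, v, w, hD'.symm ▸ hv, Or.inr ⟨le_rfl, A, by simp [hA], ?_⟩⟩
      have hAb : A ∈ D.body := by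
        rw [← hD']
        change A ∈ (mark D).marked + (mark D).rest
        simp [hA]
      -- The initial marking gives the level of the head, and membership in a definition's body
      -- gives an ADT argument.
      refine nodeWeight_eq_one ?_ ((hΔ D (hN hD)).2 A hAb)
      have hHD : D.head = some H := by
        rw [← hD']
        exact hH
      rw [← hv.head, groundLevel_map, hHD, ← hl]
      rfl
    have hc₁ : CoversMarked (definite Cls ∪ Δ) l U₁ h w := by
      clear hm1 h2 hU₂
      induction h1 with
      | refl => exact hc₀
      | tail h1 h ih => exact h.covers hΔ (hU₁ _ h1) ih
    obtain ⟨P, hP, v', w', hv', hw'⟩ := hc₁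
    -- No marked atoms are left after Phase 1, which rules out the non-strict alternative.
    have hw : w' < w := by
      refine hw'.resolve_right ?_
      rintro ⟨-, B, hB, -⟩
      rw [hm1 P hP] at hB
      exact Multiset.notMem_zero _ hB
    refine ⟨w', hw, ?_⟩
    induction h2 with
    | refl => exact ⟨_, ⟨_, ⟨P, hP, rfl⟩, rfl⟩, v', by rw [hremark]; exact hv'⟩
    | tail h2 h ih => exact h.covers hΔ (hU₂ _ h2) ih

/-! ### The procedure Replace -/

/-- Each rule only has to preserve firing instances. Clause deletion removes none, totality drops
body atoms, and functionality adds equations that every firing instance satisfies. -/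
theorem ReplaceStep.isUnfolded_and_covers (hΔ : ∀ D ∈ Δ, IsDefinition l Cls D)
    {R R' : Set (Clause S)} (hr : ReplaceStep (definite Cls) R R')
    (hR : ∀ C ∈ R, IsUnfolded l Δ C) :
    (∀ C ∈ R', IsUnfolded l Δ C) ∧ ∀ h w, Covers (definite Cls ∪ Δ) l R h w →
      Covers (definite Cls ∪ Δ) l R' h w := by
  have replace : ∀ C ∈ R, ∀ E : Clause S, IsUnfolded l Δ E →
      (∀ h w v, C.Fires (definite Cls ∪ Δ) l h w v →
        ∃ v', E.Fires (definite Cls ∪ Δ) l h w v') →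
      (∀ C' ∈ insert E (R \ {C}), IsUnfolded l Δ C') ∧ ∀ h w,
        Covers (definite Cls ∪ Δ) l R h w →
        Covers (definite Cls ∪ Δ) l (insert E (R \ {C})) h w := by
    intro C hC E hE hCE
    refine ⟨?_, ?_⟩
    · rintro C' (rfl | hC')
      · exact hE
      · exact hR C' hC'.1
    · rintro h w ⟨C', hC', v, hv⟩
      by_cases he : C' = C
      · subst he
        obtain ⟨v', hv'⟩ := hCE h w v hv
        exact ⟨E, Or.inl rfl, v', hv'⟩
      · exact ⟨C', Or.inr ⟨hC', he⟩, v, hv⟩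
  cases hr with
  | delete C hC hc =>
    refine ⟨fun C' hC' => hR C' hC'.1, ?_⟩
    rintro h w ⟨C', hC', v, hv⟩
    refine ⟨C', ⟨hC', ?_⟩, v, hv⟩
    rintro rfl
    exact hc ⟨v, hv.con⟩
  | functionality C hC G F X Y ζ hF hXY hnd hfix hinj hX hbody hfun θ hθ =>
    refine replace C hC _ ?_ fun h w v hv => ?_
    · refine (hR C hC).of_pred (headLevel_map_subst l θ C.head) fun A hA => ?_
      obtain ⟨A', hA', rfl⟩ := Multiset.mem_map.1 hA
      exact ⟨A', by rw [hbody]; exact Multiset.mem_add.2 (Or.inl hA'), rfl⟩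
    · have hb := hv.body
      have hw := hv.weight
      rw [hbody, Conj.holds_add] at hb
      rw [hbody, Conj.weight_add] at hw
      -- The rule refers to the least model of `R ∪ definite Cls`. Without defined predicates, truth
      -- in the full program descends to `definite Cls` and from there passes to that model.
      have hlm : ∀ {u : Valuation S} {F' : Conj S},
          (∀ A ∈ F', NotDefinedIn Δ A.pred) → Conj.Holds (leastModel (definite Cls ∪ Δ)) u F' →
          Conj.Holds (leastModel (R ∪ definite Cls)) u F' := fun hold hu A hA =>
        leastModel_mono Set.subset_union_right _ _ (leastModel_definite hΔ (hold A hA) (hu A hA))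
      have hFold : ∀ A ∈ F, NotDefinedIn Δ A.pred := fun A hA =>
        (hR C hC A (by simp [hbody, hA])).1
      have hb2 := hb.2
      rw [Conj.holds_subst] at hb2
      -- Both `v` and its composite with `ζ` make `F` true and agree on `X`, so functionality
      -- identifies them on `Y`.
      have hy : ∀ y ∈ Y, v y.1 y.2 = v y.1 (ζ y.1 y.2) := by
        refine hfun v ((Subst.ofNames ζ).evalAt v) (fun x hx => ?_)
          (hlm hFold (Conj.holds_add.1 hb.1).2) (hlm hFold hb2)
        change v x.1 x.2 = v x.1 (ζ x.1 x.2)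
        rw [hfix x.1 x.2 fun hxY => Set.disjoint_left.1 hXY.1 hx hxY]
      obtain ⟨v', hv'⟩ := hθ.exists_evalAt_eq v fun y hyY _ =>
        congrArg Val.toTerm (hy y hyY)
      refine ⟨v', Clause.fires_subst ?_⟩
      rw [hv']
      exact ⟨hv.head, ⟨hv.con, Cstr.eqAll_holds Y hy⟩, hb.1, le_trans (Nat.le_add_right _ _) hw⟩
  | totality C hC G F X Y hF hXY hbody hY htot =>
    refine replace C hC _ ?_ fun h w v hv => ?_
    · exact (hR C hC).of_pred rfl fun A hA =>
        ⟨A, by rw [hbody]; exact Multiset.mem_add.2 (Or.inl hA), rfl⟩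
    · have hb := hv.body
      have hw := hv.weight
      rw [hbody, Conj.holds_add] at hb
      rw [hbody, Conj.weight_add] at hw
      exact ⟨v, hv.head, hv.con, hb.1, le_trans (Nat.le_add_right _ _) hw⟩

theorem Replace.isUnfolded_and_covers (hΔ : ∀ D ∈ Δ, IsDefinition l Cls D)
    {UnfCls RCls : Set (Clause S)} (hr : Replace UnfCls (definite Cls) RCls)
    (hU : ∀ C ∈ UnfCls, IsUnfolded l Δ C) :
    (∀ C ∈ RCls, IsUnfolded l Δ C) ∧ ∀ h w, Covers (definite Cls ∪ Δ) l UnfCls h w →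
      Covers (definite Cls ∪ Δ) l RCls h w := by
  obtain ⟨h, -⟩ := hr
  induction h with
  | refl => exact ⟨hU, fun _ _ h => h⟩
  | tail _ h ih =>
    have h' := h.isUnfolded_and_covers hΔ ih.1
    exact ⟨h'.1, fun g w hc => h'.2 g w (ih.2 g w hc)⟩

/-! ### The algorithm -/

/-- The property of the states of the algorithm that every iteration preserves. -/
structure AlgInvariant (l : S.Pred → ℕ) (Cls : Set (Clause S)) (s : AlgState S) : Prop where
  definition : ∀ D ∈ s.defs, IsDefinition l Cls D
  stratified_inCls : Stratified l s.inCls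
  stratified_transfCls : Stratified l s.transfCls
  basic : ∀ C ∈ s.transfCls, C.HasBasicTypes

variable {m : Mode S}
  {prec : List ((τ : Ty S.Adt) × Term S τ) → List ((τ : Ty S.Adt) × Term S τ) → Prop}

theorem AlgInvariant.ddfInvariant {s : AlgState S} (h : AlgInvariant l Cls s) :
    DDFInvariant l Cls s.defs ⟨s.inCls, ∅, ∅⟩ where
  definition D hD := h.definition D (hD.resolve_right (Set.notMem_empty D))
  stratified C hC := h.stratified_inCls C (hC.resolve_right (Set.notMem_empty C))
  basic _ hC := hC.elim

theorem AlgStep.invariant (hs : Stratified l Cls) {s s' : AlgState S}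
    (h : AlgStep m l prec Cls s s') (hi : AlgInvariant l Cls s) : AlgInvariant l Cls s' := by
  cases h with
  | iterate InCls Defs TransfCls NewDefs FldCls UnfCls RCls _ hddf hunf hrep =>
    have hd := hi.ddfInvariant.reflTransGen hddf
    have hu := hunf.isUnfolded_and_covers hd.definition hs Set.subset_union_right
    have hr := hrep.isUnfolded_and_covers hd.definition hu.1
    refine ⟨hd.definition, fun C hC A hA => (hr.1 C hC A hA).2, ?_, ?_⟩
    · rintro C (hC | hC)
      · exact hi.stratified_transfCls C hC
      · exact hd.stratified C (Or.inr hC)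
    · rintro C (hC | hC)
      · exact hi.basic C hC
      · exact hd.basic C hC

theorem AlgInvariant.reflTransGen (hs : Stratified l Cls) {s s' : AlgState S}
    (h : Relation.ReflTransGen (AlgStep m l prec Cls) s s') (hi : AlgInvariant l Cls s) :
    AlgInvariant l Cls s' := by
  induction h with
  | refl => exact hi
  | tail _ h ih => exact h.invariant hs ih

theorem AlgStep.defs_subset {s s' : AlgState S} (h : AlgStep m l prec Cls s s') :
    s.defs ⊆ s'.defs := by
  cases h
  exact Set.subset_union_left

theorem defs_subset_of_reflTransGen_algStep {s s' : AlgState S}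
    (h : Relation.ReflTransGen (AlgStep m l prec Cls) s s') : s.defs ⊆ s'.defs := by
  induction h with
  | refl => exact subset_rfl
  | tail _ h ih => exact ih.trans h.defs_subset

/-- The instances that fire in a state still fire in the output, and the output fires with smaller
weight for every definition introduced later. -/
theorem covers_output (hs : Stratified l Cls) {T : Set (Clause S)}
    (hΔ : ∀ D ∈ Δ, IsDefinition l Cls D) {s : AlgState S}
    (h : Relation.ReflTransGen (AlgStep m l prec Cls) s ⟨∅, Δ, T⟩)
    (hi : AlgInvariant l Cls s) :
    (∀ g w, Covers (definite Cls ∪ Δ) l (s.inCls ∪ s.transfCls) g w →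
      Covers (definite Cls ∪ Δ) l T g w) ∧
    ∀ D ∈ Δ, D ∉ s.defs → ∀ g w v, D.Fires (definite Cls ∪ Δ) l g w v →
      ∃ w' < w, Covers (definite Cls ∪ Δ) l T g w' := by
  -- Induction from the start of the run keeps the final `Δ`, and with it the least model, fixed.
  induction h using Relation.ReflTransGen.head_induction_on with
  | refl =>
    exact ⟨fun g w hc => hc.mono (Set.empty_union _).subset, fun D hD hD' => absurd hD hD'⟩
  | head h h' ih =>
    obtain ⟨ih1, ih2⟩ := ih (h.invariant hs hi)
    have hsub := defs_subset_of_reflTransGen_algStep h'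
    cases h with
    | iterate InCls Defs TransfCls NewDefs FldCls UnfCls RCls _ hddf hunf hrep =>
      have hu := hunf.isUnfolded_and_covers hΔ hs (Set.subset_union_right.trans hsub)
      have hr := hrep.isUnfolded_and_covers hΔ hu.1
      refine ⟨fun g w hc => ih1 g w ?_, fun D hD hD' g w v hv => ?_⟩
      · obtain ⟨C, hC | hC, v, hv⟩ := hc
        · obtain ⟨E, hE, v', hv'⟩ := covers_of_reflTransGen_ddfStep hddf hi.ddfInvariant hsub hΔ
            (stratified_program hs hΔ) ⟨C, Or.inl hC, v, hv⟩
          exact ⟨E, Or.inr (Or.inr (hE.resolve_left (Set.notMem_empty E))), v', hv'⟩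
        · exact ⟨C, Or.inr (Or.inl hC), v, hv⟩
      -- A definition of this iteration is unfolded now, which gives the strict drop; for one
      -- introduced later, the drop is provided by the induction hypothesis.
      · by_cases hDN : D ∈ NewDefs
        · obtain ⟨w', hw', hc⟩ := hu.2 D hDN g w v hv
          exact ⟨w', hw', ih1 g w' ((hr.2 g w' hc).mono Set.subset_union_left)⟩
        · exact ih2 D hD (fun h => h.elim hD' hDN) g w v hv

/-- The new predicates, as defined by `Δ`, are true in every model of the output. -/
theorem holds_of_isModel (hΔ : ∀ D ∈ Δ, IsDefinition l Cls D)
    {T : Set (Clause S)} (hT : Stratified l T)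
    (hfresh : ∀ C ∈ Cls, ∀ H, C.head = some H → ∀ E ∈ T, ¬ E.Mentions H.pred)
    (hcov : ∀ D ∈ Δ, ∀ g w v, D.Fires (definite Cls ∪ Δ) l g w v →
      ∃ w' < w, Covers (definite Cls ∪ Δ) l T g w')
    {J : Interp S} (hJ : IsModel J T) (n w : ℕ) (g : GAtom S) (hn : l g.1 = n)
    (hw : g.weight (definite Cls ∪ Δ) l n ≤ w) (hg : leastModel (definite Cls ∪ Δ) g.1 g.2)
    (hgT : ∃ E ∈ T, E.Mentions g.1) : J g.1 g.2 := by
  -- Lexicographic induction on level and weight. The weight is generalized because, at a lower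
  -- level, it is measured anew at that level and has no relation to the present one.
  induction n using Nat.strong_induction_on generalizing w g with
  | _ n ihn =>
    induction w using Nat.strong_induction_on generalizing g with
    | _ w ihw =>
      obtain ⟨D, hD, H, hH, v, rfl, hcon, hb, hDw⟩ :=
        leastModel_inversion (head_ne_none_of_mem hΔ) l n hg
      obtain ⟨E₀, hE₀, hm⟩ := hgT
      -- The freshness assumption enters here: a predicate occurring in the output is not the head
      -- predicate of a clause of `Cls`, so the proof of the atom ends with a definition.
      have hDΔ : D ∈ Δ := hD.resolve_left fun hD => hfresh D hD.1 H hH E₀ hE₀ hm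
      obtain ⟨w', hw', E, hE, v', hv'⟩ := hcov D hDΔ (some (H.ground v)) w v
        ⟨by rw [hH]; rfl, hcon, hb, by
          change Conj.weight _ _ (l (H.ground v).1 : WithTop ℕ) _ _ ≤ _
          rw [hn]
          omega⟩
      have hlev : headLevel l E.head = n := by
        rw [← groundLevel_map l v', hv'.head, ← hn]
        rfl
      have hEJ : Conj.Holds J v' E.body := by
        intro A hA
        have hAT : ∃ E ∈ T, E.Mentions (A.ground v').1 := ⟨E, hE, Or.inr ⟨A, hA, rfl⟩⟩
        have hAl : l A.pred ≤ n := by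
          have := hT E hE A hA
          rw [hlev] at this
          exact WithTop.coe_le_coe.1 this
        rcases hAl.lt_or_eq with hlt | heq
        · exact ihn _ hlt _ (A.ground v') rfl le_rfl (hv'.body A hA) hAT
        -- At equal level, a single body atom weighs no more than the whole body, which is below
        -- `w`.
        · refine ihw w' hw' (A.ground v') heq ?_ (hv'.body A hA) hAT
          refine (Conj.weight_mem_le hA).trans ?_
          have := hv'.weight
          rwa [← hv'.head, groundLevel_map, hlev] at this
      obtain ⟨A, hA, hAJ⟩ := hJ E hE v' hv'.con hEJ
      have he := hv'.head
      rw [hA] at he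
      have he' : A.ground v' = H.ground v := Option.some.inj he
      rw [← he']
      exact hAJ

end

end CHC

/-! ### Soundness of the algorithm -/

theorem theorem5 {S : CHC.Sig}
    (hS : ∀ a : S.Adt, Nonempty (CHC.Val S (.adt a)))
    (m : CHC.Mode S)
    (prec : List ((τ : CHC.Ty S.Adt) × CHC.Term S τ) →
      List ((τ : CHC.Ty S.Adt) × CHC.Term S τ) → Prop)
    (l : S.Pred → ℕ)
    (Cls TransfCls : Set (CHC.Clause S))
    (hstrat : CHC.Stratified l Cls)
    (hrun : CHC.AlgorithmR m l prec Cls TransfCls) :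
    (∀ C ∈ TransfCls, C.HasBasicTypes) ∧
    ((∀ C ∈ Cls, ∀ H, C.head = some H → ∀ E ∈ TransfCls, ¬ E.Mentions H.pred) →
      CHC.Satisfiable TransfCls → CHC.Satisfiable Cls) := by
  open CHC in
  obtain ⟨Δ, hrun⟩ := hrun
  have hinit : AlgInvariant l Cls ⟨goals Cls, ∅, ∅⟩ :=
    ⟨fun _ h => h.elim, fun C hC => hstrat C hC.1, fun _ h => h.elim, fun _ h => h.elim⟩
  have hfin := hinit.reflTransGen hstrat hrun
  have hΔ := hfin.definition
  obtain ⟨hgoal, hdef⟩ := covers_output hstrat hΔ hrun hinit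
  refine ⟨hfin.basic, fun hfresh ⟨J, hJ⟩ => ⟨leastModel (definite Cls ∪ Δ), fun C hC => ?_⟩⟩
  by_cases hhead : C.head = none
  · intro v hv hb
    exfalso
    -- For a goal the weight bound plays no role, so it is taken to be the weight of the body
    -- itself.
    obtain ⟨E, hE, v', hv'⟩ := hgoal none _
      ⟨C, Or.inl ⟨hC, hhead⟩, v, by rw [hhead]; rfl, hv, hb, le_rfl⟩
    obtain ⟨A, hA, -⟩ := hJ E hE v' hv'.con fun A hA =>
      holds_of_isModel hΔ hfin.stratified_transfCls hfresh
        (fun D hD => hdef D hD (Set.notMem_empty D)) hJ _ _ (A.ground v') rfl le_rfl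
        (hv'.body A hA) ⟨E, hE, Or.inr ⟨A, hA, rfl⟩⟩
    have := hv'.head
    rw [hA] at this
    cases this
  · exact isModel_leastModel (head_ne_none_of_mem hΔ) C (Or.inl ⟨hC, hhead⟩)
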